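/- Let $0<q<1$ and $n\ge 1$. Let $\mathcal O(S^{2n+1}_q)$ be the complex unital $*$-algebra generated by $z_0,\dots,z_n$ with relations $z_iz_j=q^{-1}z_jz_i$ for $i<j$, $z_i^*z_j=q\,z_jz_i^*$ for $i\neq j$, $[z_i^*,z_i]=(1-q^2)\sum_{j>i}z_jz_j^*$ for $0\le i\le n$, and $\sum_{i=0}^n z_iz_i^*=1$. Let $p_0,\dots,p_n$ be pairwise coprime positive integers, $\ell_i=\prod_{j\ne i}p_j$, $p=\prod_{j}p_j$, and let $\mathcal O(\mathbb P_q(\underline\ell))$ (respectively $\mathcal O(L_q(p;\underline\ell))\supseteq\mathcal O(\mathbb P_q(\underline\ell))$) be the $*$-subalgebra of elements that are invariant under the $*$-automorphisms $z_i\mapsto t^{\ell_i}z_i$ for all $t\in\mathrm U(1)$ (respectively for all $t$ with $t^p=1$). Put $x_i=z_iz_i^*$ and $\zeta_i=z_i^{p_i}$; these are elements of $\mathcal O(L_q(p;\underline\ell))$. Fix integers $r_0,\dots,r_{n-1}$ with $0\le r_i<p_i$. Let $\mathcal H_n=\ell^2(\mathbb N^n)$ with canonical orthonormal basis $|\vec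 m\rangle$, $\vec m=(m_1,\dots,m_n)$, and put $m_0=0$. For $0\le k\le n$ let $\mathcal V_k\subseteq\mathcal H_n$ be the closed span of the $|\vec m\rangle$ with $m_1\le\dots\le m_k$ and $m_{k+1}>\dots>m_n$. For such $\vec m$ and $0\le i<k$ put $\kappa_i=p_i(m_{i+1}-m_i)+r_i$ and, for $0\le i\le k$, $S_i=\kappa_0+\dots+\kappa_{i-1}$; let $\vec e_{ik}\in\mathbb N^n$ consist of $i$ zeros, then $k-i$ ones, then $n-k$ zeros. Then for every $0\le k\le n$ there is exactly one (not necessarily unital) $*$-homomorphism $\pi^{(n)}_k:\mathcal O(L_q(p;\underline\ell))\to\mathcal B(\mathcal H_n)$ such that all $\pi^{(n)}_k(x_i)$ and $\pi^{(n)}_k(\zeta_i)$ vanish on $\mathcal V_k^\perp$, $\pi^{(n)}_k(x_i)=\pi^{(n)}_k(\zeta_i)=0$ for $i>k$, and on the basis vectors $|\vec m\rangle$ of $\mathcal V_k$ $$\pi^{(n)}_k(x_i)|\vec m\rangle=q^{2S_i}(1-q^{2\kappa_i})|\vec m\rangle,\qquad \pi^{(n)}_k(\zeta_i)|\vec m\rangle=q^{p_iS_i}\Big(\prod_{s=\kappa_i+1}^{\kappa_i+p_i}(1-q^{2s})\Big)^{1/2}|\vec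 m+\vec e_{ik}\rangle\qquad(0\le i<k),$$ $$\pi^{(n)}_k(x_k)|\vec m\rangle=q^{2S_k}|\vec m\rangle,\qquad \pi^{(n)}_k(\zeta_k)|\vec m\rangle=q^{p_kS_k}|\vec m\rangle .$$ Put $\pi^{(n)}_+=\sum_{k\text{ even}}\pi^{(n)}_k$ and $\pi^{(n)}_-=\sum_{k\text{ odd}}\pi^{(n)}_k$ (sums over $0\le k\le n$). For every $a\in\mathcal O(\mathbb P_q(\underline\ell))$ the operator $\pi_+^{(n)}(a)-\pi_-^{(n)}(a)$ is of trace class on $\mathcal H_n$, and its trace is the sum of the series $\sum_{\vec m\in\mathbb N^n}\langle\vec m|\pi_+^{(n)}(a)-\pi_-^{(n)}(a)|\vec m\rangle$, which converges absolutely (for each $0<q<1$). Consequently, with $F(v\oplus w)=w\oplus v$ and $\gamma(v\oplus w)=v\oplus(-w)$ on $\mathcal H_n\oplus\mathcal H_n$, the datum $(\mathcal O(\mathbb P_q(\underline\ell)),\ \mathcal H_n\oplus\mathcal H_n,\ \pi_+^{(n)}\oplus\pi_-^{(n)},\ F,\ \gamma)$ is a $1$-summable even Fredholm module: $\pi_+^{(n)}\oplus\pi_-^{(n)}$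 is a (not necessarily unital) $*$-representation commuting with $\gamma=\gamma^*$, $\gamma^2=1$; $F=F^*$, $F^2=1$, $F\gamma=-\gamma F$; and all commutators $[F,\pi_+^{(n)}(a)\oplus\pi_-^{(n)}(a)]$ are compact and of trace class. -/

import Mathlib

namespace QWP

/-! ### The coordinate algebra of the quantum sphere -/

/-- The free complex unital `*`-algebra on `X`: the monoid algebra of words in the letters
`(x, false)`, standing for `x`, and `(x, true)`, standing for `x*`. -/
abbrev FreeStarAlg (X : Type) : Type := MonoidAlgebra ℂ (FreeMonoid (X × Bool))

namespace FreeStarAlg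
variable {X : Type}

/-- A letter, as an element of the free `*`-algebra. -/
noncomputable def letter (l : X × Bool) : FreeStarAlg X := MonoidAlgebra.of ℂ _ (FreeMonoid.of l)

/-- The generator `x`. -/
noncomputable def gen (x : X) : FreeStarAlg X := letter (x, false)

theorem starHom_comm (c : ℂ) (w : FreeMonoid (X × Bool)) :
    Commute (((algebraMap ℂ (FreeStarAlg X)ᵐᵒᵖ).comp (starRingEnd ℂ)) c)
      ((FreeMonoid.lift fun l : X × Bool =>
        MulOpposite.op (letter (X := X) (l.1, !l.2))) w) :=
  Algebra.commutes (A := (FreeStarAlg X)ᵐᵒᵖ) (star c) _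

/-- The conjugate-linear anti-endomorphism exchanging `x` and `x*`. -/
noncomputable def starHom : FreeStarAlg X →+* (FreeStarAlg X)ᵐᵒᵖ :=
  MonoidAlgebra.liftNCRingHom
    ((algebraMap ℂ (FreeStarAlg X)ᵐᵒᵖ).comp (starRingEnd ℂ))
    (FreeMonoid.lift fun l => MulOpposite.op (letter (l.1, !l.2)))
    starHom_comm

noncomputable instance : Star (FreeStarAlg X) := ⟨fun a => (starHom a).unop⟩

theorem star_def (a : FreeStarAlg X) : star a = (starHom a).unop := rfl

theorem induction {P : FreeStarAlg X → Prop} (a : FreeStarAlg X)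
    (hc : ∀ c : ℂ, P (algebraMap ℂ _ c)) (hl : ∀ l, P (letter l))
    (hadd : ∀ a b, P a → P b → P (a + b)) (hmul : ∀ a b, P a → P b → P (a * b)) : P a := by
  refine MonoidAlgebra.induction_on a (fun m => ?_) hadd (fun c f hf => ?_)
  · refine FreeMonoid.inductionOn m ?_ (fun l => hl l) (fun x y hx hy => ?_)
    · simpa using hc 1
    · rw [map_mul]; exact hmul _ _ hx hy
  · rw [Algebra.smul_def]; exact hmul _ _ (hc c) hf

theorem star_mul' (a b : FreeStarAlg X) : star (a * b) = star b * star a := by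
  simp [star_def]

theorem star_add' (a b : FreeStarAlg X) : star (a + b) = star a + star b := by
  simp [star_def]

theorem star_letter (l : X × Bool) : star (letter l) = letter (l.1, !l.2) := by
  simp [star_def, starHom, letter, MonoidAlgebra.of]

theorem star_algebraMap' (c : ℂ) :
    star (algebraMap ℂ (FreeStarAlg X) c) = algebraMap ℂ _ (star c) := by
  have h : starHom (MonoidAlgebra.single 1 c : FreeStarAlg X) =
      algebraMap ℂ (FreeStarAlg X)ᵐᵒᵖ (star c) * 1 := by
    rw [starHom, MonoidAlgebra.liftNCRingHom_single, map_one]; rfl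
  change (starHom (MonoidAlgebra.single 1 c : FreeStarAlg X)).unop = _
  rw [h, mul_one]; rfl

noncomputable instance : StarRing (FreeStarAlg X) where
  star_involutive a := by
    refine induction (P := fun a => star (star a) = a) a (fun c => ?_) (fun l => ?_) (fun a b ha hb => ?_) (fun a b ha hb => ?_)
    · rw [star_algebraMap', star_algebraMap', star_star]
    · rw [star_letter, star_letter, Bool.not_not]
    · rw [star_add', star_add', ha, hb]
    · rw [star_mul', star_mul', ha, hb]
  star_mul := star_mul'
  star_add := star_add'

noncomputable instance : StarModule ℂ (FreeStarAlg X) where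
  star_smul c a := by
    rw [Algebra.smul_def, Algebra.smul_def, star_mul', star_algebraMap', Algebra.commutes]

/-- The `*`-homomorphism with prescribed values on the generators. -/
noncomputable def lift {B : Type*} [Ring B] [StarRing B] [Algebra ℂ B] [StarModule ℂ B]
    (w : X → B) : FreeStarAlg X →⋆ₐ[ℂ] B where
  __ := MonoidAlgebra.lift ℂ B (FreeMonoid (X × Bool))
    (FreeMonoid.lift fun l => if l.2 then star (w l.1) else w l.1)
  map_star' a := by
    set F := MonoidAlgebra.lift ℂ B (FreeMonoid (X × Bool))
      (FreeMonoid.lift fun l => if l.2 then star (w l.1) else w l.1) with hF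
    change F (star a) = star (F a)
    refine induction (P := fun a => F (star a) = star (F a)) a
      (fun c => ?_) (fun l => ?_) (fun a b ha hb => ?_) (fun a b ha hb => ?_)
    · rw [star_algebraMap', AlgHom.commutes, AlgHom.commutes, algebraMap_star_comm]
    · rw [star_letter]
      rcases l with ⟨x, b⟩
      cases b <;> simp [hF, letter]
    · rw [star_add, map_add, map_add, star_add, ha, hb]
    · rw [star_mul, map_mul, map_mul, star_mul, ha, hb]


@[simp] theorem lift_gen {B : Type*} [Ring B] [StarRing B] [Algebra ℂ B] [StarModule ℂ B]
    (w : X → B) (x : X) : lift w (gen x) = w x := by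
  change MonoidAlgebra.lift ℂ B (FreeMonoid (X × Bool)) _ (gen x) = w x
  simp [gen, letter]

end FreeStarAlg

open FreeStarAlg in
/-- The defining relations of the quantum sphere of dimension `2n+1`, with generators
`z_0, ..., z_n`, together with their adjoints. The relation for `z_n* z_n - z_n z_n*` is
`commutator` with an empty sum. -/
inductive SphereRel (n : ℕ) (q : ℝ) :
    FreeStarAlg (Fin (n + 1)) → FreeStarAlg (Fin (n + 1)) → Prop
  | gen_gen (i j : Fin (n + 1)) (h : i < j) :
      SphereRel n q (gen i * gen j) ((q : ℂ)⁻¹ • (gen j * gen i))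
  | star_gen (i j : Fin (n + 1)) (h : i ≠ j) :
      SphereRel n q (star (gen i) * gen j) ((q : ℂ) • (gen j * star (gen i)))
  | commutator (i : Fin (n + 1)) :
      SphereRel n q (star (gen i) * gen i - gen i * star (gen i))
        ((1 - (q : ℂ) ^ 2) • ∑ j ∈ Finset.Ioi i, gen j * star (gen j))
  | sphere : SphereRel n q (∑ i, gen i * star (gen i)) 1
  | star_closed (a b : FreeStarAlg (Fin (n + 1))) (h : SphereRel n q a b) :
      SphereRel n q (star a) (star b)

/-- The coordinate `*`-algebra of the quantum sphere of dimension `2n+1`. -/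
def Sphere (n : ℕ) (q : ℝ) : Type := RingQuot (SphereRel n q)

namespace Sphere
variable {n : ℕ} {q : ℝ}

noncomputable instance : Ring (Sphere n q) := inferInstanceAs (Ring (RingQuot (SphereRel n q)))
noncomputable instance : Algebra ℂ (Sphere n q) :=
  inferInstanceAs (Algebra ℂ (RingQuot (SphereRel n q)))

/-- The quotient map from the free `*`-algebra. -/
noncomputable def mk : FreeStarAlg (Fin (n + 1)) →ₐ[ℂ] Sphere n q :=
  RingQuot.mkAlgHom ℂ (SphereRel n q)

theorem mk_surjective : Function.Surjective (mk : FreeStarAlg (Fin (n + 1)) → Sphere n q) :=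
  RingQuot.mkAlgHom_surjective ℂ (SphereRel n q)

theorem mk_rel {a b : FreeStarAlg (Fin (n + 1))} (h : SphereRel n q a b) :
    (mk a : Sphere n q) = mk b :=
  RingQuot.mkAlgHom_rel ℂ h

/-- The involution, as a ring homomorphism to the opposite ring. -/
noncomputable def starHom : Sphere n q →+* (Sphere n q)ᵐᵒᵖ :=
  RingQuot.lift (r := SphereRel n q)
    ⟨(mk : FreeStarAlg (Fin (n + 1)) →ₐ[ℂ] Sphere n q).toRingHom.op.comp
        (starRingEquiv : FreeStarAlg (Fin (n + 1)) ≃+* _).toRingHom,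
      fun a b h => by
        change MulOpposite.op (mk (star a) : Sphere n q) = MulOpposite.op (mk (star b))
        rw [mk_rel (h.star_closed)]⟩

noncomputable instance : Star (Sphere n q) := ⟨fun a => (starHom a).unop⟩

theorem mk_star (a : FreeStarAlg (Fin (n + 1))) :
    (mk (star a) : Sphere n q) = star (mk a) := by
  have h : starHom (mk a : Sphere n q) = MulOpposite.op (mk (star a)) := by
    have hm : (mk a : Sphere n q) = RingQuot.mkRingHom (SphereRel n q) a := by
      simp only [mk, ← RingQuot.mkAlgHom_coe ℂ]; rfl
    rw [hm]
    exact RingQuot.lift_mkRingHom_apply _ _ _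
  change _ = (starHom (mk a : Sphere n q)).unop
  rw [h, MulOpposite.unop_op]

noncomputable instance : StarRing (Sphere n q) where
  star_involutive a := by
    obtain ⟨a, rfl⟩ := mk_surjective a
    rw [← mk_star, ← mk_star, star_star]
  star_mul a b := by
    obtain ⟨a, rfl⟩ := mk_surjective a
    obtain ⟨b, rfl⟩ := mk_surjective b
    rw [← map_mul, ← mk_star, star_mul, map_mul, mk_star, mk_star]
  star_add a b := by
    obtain ⟨a, rfl⟩ := mk_surjective a
    obtain ⟨b, rfl⟩ := mk_surjective b
    rw [← map_add, ← mk_star, star_add, map_add, mk_star, mk_star]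

noncomputable instance : StarModule ℂ (Sphere n q) where
  star_smul c a := by
    obtain ⟨a, rfl⟩ := mk_surjective a
    rw [← map_smul, ← mk_star, ← mk_star, star_smul, map_smul]

/-- The generators `z_i`. -/
noncomputable def z (i : Fin (n + 1)) : Sphere n q := mk (FreeStarAlg.gen i)

/-- The family `w` satisfies the defining relations of the quantum sphere. -/
structure IsSphereFamily {B : Type*} [Ring B] [StarRing B] [Algebra ℂ B] (q : ℝ)
    (w : Fin (n + 1) → B) : Prop where
  gen_gen : ∀ i j, i < j → w i * w j = (q : ℂ)⁻¹ • (w j * w i)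
  star_gen : ∀ i j, i ≠ j → star (w i) * w j = (q : ℂ) • (w j * star (w i))
  commutator : ∀ i, star (w i) * w i - w i * star (w i) =
    (1 - (q : ℂ) ^ 2) • ∑ j ∈ Finset.Ioi i, w j * star (w j)
  sphere : ∑ i, w i * star (w i) = 1

theorem isSphereFamily_z : IsSphereFamily q (z : Fin (n + 1) → Sphere n q) where
  gen_gen i j h := by simpa [z] using mk_rel (q := q) (SphereRel.gen_gen i j h)
  star_gen i j h := by
    simpa [z, mk_star, -Complex.coe_smul] using mk_rel (q := q) (SphereRel.star_gen i j h)
  commutator i := by simpa [z, mk_star] using mk_rel (q := q) (SphereRel.commutator i)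
  sphere := by simpa [z, mk_star] using mk_rel (SphereRel.sphere (n := n) (q := q))

/-- The universal property of the quantum sphere algebra. -/
noncomputable def lift {B : Type*} [Ring B] [StarRing B] [Algebra ℂ B] [StarModule ℂ B]
    (w : Fin (n + 1) → B) (hw : IsSphereFamily q w) : Sphere n q →⋆ₐ[ℂ] B where
  __ := RingQuot.liftAlgHom ℂ (s := SphereRel n q)
    ⟨(FreeStarAlg.lift w).toAlgHom, fun a b h => by
      change FreeStarAlg.lift w a = FreeStarAlg.lift w b
      induction h with
      | gen_gen i j h => simpa using hw.gen_gen i j h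
      | star_gen i j h => simpa [map_star, -Complex.coe_smul] using hw.star_gen i j h
      | commutator i => simpa [map_star] using hw.commutator i
      | sphere => simpa [map_star] using hw.sphere
      | star_closed a b h ih => rw [map_star, map_star, ih]⟩
  map_star' a := by
    obtain ⟨a, rfl⟩ := mk_surjective a
    rw [← mk_star]
    refine (RingQuot.liftAlgHom_mkAlgHom_apply ℂ _ _ (star a)).trans ?_
    refine (map_star (FreeStarAlg.lift w) a).trans ?_
    exact congrArg star (RingQuot.liftAlgHom_mkAlgHom_apply ℂ _ _ a).symm

@[simp] theorem lift_z {B : Type*} [Ring B] [StarRing B] [Algebra ℂ B] [StarModule ℂ B]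
    (w : Fin (n + 1) → B) (hw : IsSphereFamily q w) (i : Fin (n + 1)) :
    lift w hw (z i) = w i :=
  (RingQuot.liftAlgHom_mkAlgHom_apply ℂ _ _ (FreeStarAlg.gen i)).trans (FreeStarAlg.lift_gen w i)

theorem isSphereFamily_smul (c : Fin (n + 1) → Circle) :
    IsSphereFamily q (fun i => (c i : ℂ) • (z i : Sphere n q)) := by
  have hc : ∀ i, (c i : ℂ) * star (c i : ℂ) = 1 := fun i => by
    rw [Complex.star_def, Complex.mul_conj, Circle.normSq_coe, Complex.ofReal_one]
  have hz := isSphereFamily_z (n := n) (q := q)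
  constructor
  · intro i j h
    simp only [smul_mul_smul_comm]
    rw [hz.gen_gen i j h, smul_comm, mul_comm]
  · intro i j h
    simp only [star_smul, smul_mul_smul_comm]
    rw [hz.star_gen i j h, smul_comm, mul_comm]
  · intro i
    simp only [star_smul, smul_mul_smul_comm, hc, mul_comm (star _), one_smul]
    exact hz.commutator i
  · simp only [star_smul, smul_mul_smul_comm, hc, one_smul]
    exact hz.sphere

/-- The weighted action of `U(1)`: `z_i ↦ t ^ ℓ_i z_i`. -/
noncomputable def action (ℓ : Fin (n + 1) → ℕ) (t : Circle) : Sphere n q →⋆ₐ[ℂ] Sphere n q :=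
  lift (fun i => ((t ^ ℓ i : Circle) : ℂ) • z i) (isSphereFamily_smul fun i => t ^ ℓ i)

theorem action_z (ℓ : Fin (n + 1) → ℕ) (t : Circle) (i : Fin (n + 1)) :
    action ℓ t (z i : Sphere n q) = ((t ^ ℓ i : Circle) : ℂ) • z i :=
  lift_z _ _ i

end Sphere

/-! ### Weighted projective spaces and lens spaces -/

/-- The weight vector whose `i`-th entry is the product of all `p_j`, `j ≠ i`. -/
def sharp {n : ℕ} (p : Fin (n + 1) → ℕ) (i : Fin (n + 1)) : ℕ :=
  ∏ j ∈ Finset.univ.erase i, p j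

theorem sharp_mul {n : ℕ} (p : Fin (n + 1) → ℕ) (i : Fin (n + 1)) :
    sharp p i * p i = ∏ j, p j :=
  Finset.prod_erase_mul Finset.univ p (Finset.mem_univ i)

/-- The coordinate algebra of the quantum weighted projective space: the elements of the sphere
algebra that are invariant under the weighted action of `U(1)`. -/
noncomputable def weightedProj (n : ℕ) (q : ℝ) (ℓ : Fin (n + 1) → ℕ) :
    StarSubalgebra ℂ (Sphere n q) :=
  ⨅ t : Circle, StarAlgHom.equalizer (Sphere.action ℓ t) (StarAlgHom.id ℂ (Sphere n q))

/-- The coordinate algebra of the quantum lens space: the elements of the sphere algebra that are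
invariant under the action of the `N`-th roots of unity. -/
noncomputable def lens (n : ℕ) (q : ℝ) (N : ℕ) (ℓ : Fin (n + 1) → ℕ) :
    StarSubalgebra ℂ (Sphere n q) :=
  ⨅ t : {t : Circle // t ^ N = 1},
    StarAlgHom.equalizer (Sphere.action ℓ t.1) (StarAlgHom.id ℂ (Sphere n q))

theorem mem_weightedProj {n : ℕ} {q : ℝ} {ℓ : Fin (n + 1) → ℕ} {a : Sphere n q} :
    a ∈ weightedProj n q ℓ ↔ ∀ t : Circle, Sphere.action ℓ t a = a := by
  simp [weightedProj, StarSubalgebra.mem_iInf]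

theorem mem_lens {n : ℕ} {q : ℝ} {N : ℕ} {ℓ : Fin (n + 1) → ℕ} {a : Sphere n q} :
    a ∈ lens n q N ℓ ↔ ∀ t : Circle, t ^ N = 1 → Sphere.action ℓ t a = a := by
  simp [lens, StarSubalgebra.mem_iInf]

theorem weightedProj_le_lens (n : ℕ) (q : ℝ) (N : ℕ) (ℓ : Fin (n + 1) → ℕ) :
    weightedProj n q ℓ ≤ lens n q N ℓ := fun _ ha =>
  mem_lens.2 fun t _ => mem_weightedProj.1 ha t

/-- The lens space algebra with weight vector `sharp p` and the cyclic group of order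
`p_0 p_1 ... p_n`. -/
noncomputable abbrev sharpLens (n : ℕ) (q : ℝ) (p : Fin (n + 1) → ℕ) :
    StarSubalgebra ℂ (Sphere n q) :=
  lens n q (∏ j, p j) (sharp p)

/-- The element `x_i = z_i z_i*` of the lens space algebra. -/
noncomputable def lensX {n : ℕ} {q : ℝ} (p : Fin (n + 1) → ℕ) (i : Fin (n + 1)) :
    sharpLens n q p :=
  ⟨Sphere.z i * star (Sphere.z i), mem_lens.2 fun t _ => by
    have h : ((t ^ sharp p i : Circle) : ℂ) * star ((t ^ sharp p i : Circle) : ℂ) = 1 := by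
      rw [Complex.star_def, Complex.mul_conj, Circle.normSq_coe, Complex.ofReal_one]
    rw [map_mul, map_star, Sphere.action_z, star_smul, smul_mul_smul_comm, h, one_smul]⟩

/-- The element `ζ_i = z_i ^ p_i` of the lens space algebra. -/
noncomputable def lensZeta {n : ℕ} {q : ℝ} (p : Fin (n + 1) → ℕ) (i : Fin (n + 1)) :
    sharpLens n q p :=
  ⟨Sphere.z i ^ p i, mem_lens.2 fun t ht => by
    rw [map_pow, Sphere.action_z, smul_pow, ← Circle.coe_pow, ← pow_mul, sharp_mul, ht,
      Circle.coe_one, one_smul]⟩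

/-! ### The representations on `ℓ²(ℕⁿ)` -/

/-- The Hilbert space `ℓ²(ℕⁿ)`. -/
abbrev Hn (n : ℕ) : Type := lp (fun _ : Fin n → ℕ => ℂ) 2

/-- The canonical orthonormal basis vectors of `ℓ²(ℕⁿ)`. -/
noncomputable def ket {n : ℕ} (m : Fin n → ℕ) : Hn n := lp.single 2 m (1 : ℂ)

/-- The components `m_1, ..., m_n` of `m`, with the convention `m_0 = 0`. -/
def coord {n : ℕ} (m : Fin n → ℕ) : ℕ → ℕ
  | 0 => 0
  | j + 1 => if h : j < n then m ⟨j, h⟩ else 0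

/-- The index set of the canonical basis of the subspace `V_k`:
`0 ≤ m_1 ≤ ... ≤ m_k` and `m_{k+1} > ... > m_n ≥ 0`. -/
def InV {n : ℕ} (k : Fin (n + 1)) (m : Fin n → ℕ) : Prop :=
  (∀ i j : ℕ, 1 ≤ i → i ≤ j → j ≤ k → coord m i ≤ coord m j) ∧
  (∀ i j : ℕ, (k : ℕ) < i → i < j → j ≤ n → coord m j < coord m i)

/-- `κ_j = p_j (m_{j+1} - m_j) + r_j` for `0 ≤ j < n`. It is used only for `j < k` and `m` in the
index set of `V_k`, where `m_j ≤ m_{j+1}`, so that the subtraction is the usual one. -/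
def kappa {n : ℕ} (p : Fin (n + 1) → ℕ) (r : Fin n → ℕ) (m : Fin n → ℕ) (j : Fin n) : ℕ :=
  p j.castSucc * (coord m (j + 1) - coord m j) + r j

/-- `κ_0 + ... + κ_{i-1}`. -/
def kappaSum {n : ℕ} (p : Fin (n + 1) → ℕ) (r : Fin n → ℕ) (m : Fin n → ℕ) (i : ℕ) : ℕ :=
  ∑ j ∈ Finset.univ.filter (fun j : Fin n => (j : ℕ) < i), kappa p r m j

/-- The vector in `ℕⁿ` consisting of `i` zeros, then `k - i` ones, then `n - k` zeros. -/
def eVec {n : ℕ} (i k : ℕ) : Fin n → ℕ := fun l => if i ≤ l ∧ (l : ℕ) < k then 1 else 0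

/-- `π` is the representation `π_k` of the lens space algebra on `ℓ²(ℕⁿ)`, which is given on the
generators `x_i` and `ζ_i` by the following formulas on `V_k` and by zero on its orthogonal
complement. -/
structure IsBlockRep {n : ℕ} {q : ℝ} (p : Fin (n + 1) → ℕ) (r : Fin n → ℕ) (k : Fin (n + 1))
    (π : sharpLens n q p →⋆ₙₐ[ℂ] (Hn n →L[ℂ] Hn n)) : Prop where
  x_gt : ∀ i, k < i → π (lensX p i) = 0
  zeta_gt : ∀ i, k < i → π (lensZeta p i) = 0
  x_off : ∀ i m, ¬ InV k m → π (lensX p i) (ket m) = 0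
  zeta_off : ∀ i m, ¬ InV k m → π (lensZeta p i) (ket m) = 0
  x_lt : ∀ (i : Fin n) (m : Fin n → ℕ), i.castSucc < k → InV k m →
    π (lensX p i.castSucc) (ket m) =
      ((q ^ (2 * kappaSum p r m i) * (1 - q ^ (2 * kappa p r m i)) : ℝ) : ℂ) • ket m
  x_self : ∀ m : Fin n → ℕ, InV k m →
    π (lensX p k) (ket m) = ((q ^ (2 * kappaSum p r m k) : ℝ) : ℂ) • ket m
  zeta_lt : ∀ (i : Fin n) (m : Fin n → ℕ), i.castSucc < k → InV k m →
    π (lensZeta p i.castSucc) (ket m) =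
      ((q ^ (p i.castSucc * kappaSum p r m i) *
        √(∏ s ∈ Finset.Ioc (kappa p r m i) (kappa p r m i + p i.castSucc),
          (1 - q ^ (2 * s))) : ℝ) : ℂ) • ket (m + eVec i k)
  zeta_self : ∀ m : Fin n → ℕ, InV k m →
    π (lensZeta p k) (ket m) = ((q ^ (p k * kappaSum p r m k) : ℝ) : ℂ) • ket m

/-- `π_+(a) = ∑ π_k(a)` over the even `k` in `{0, ..., n}`. -/
noncomputable def piPlus {n : ℕ} {q : ℝ} {p : Fin (n + 1) → ℕ}
    (π : Fin (n + 1) → (sharpLens n q p →⋆ₙₐ[ℂ] (Hn n →L[ℂ] Hn n))) (a : sharpLens n q p) :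
    Hn n →L[ℂ] Hn n :=
  ∑ k ∈ Finset.univ.filter (fun k : Fin (n + 1) => Even (k : ℕ)), π k a

/-- `π_-(a) = ∑ π_k(a)` over the odd `k` in `{0, ..., n}`. -/
noncomputable def piMinus {n : ℕ} {q : ℝ} {p : Fin (n + 1) → ℕ}
    (π : Fin (n + 1) → (sharpLens n q p →⋆ₙₐ[ℂ] (Hn n →L[ℂ] Hn n))) (a : sharpLens n q p) :
    Hn n →L[ℂ] Hn n :=
  ∑ k ∈ Finset.univ.filter (fun k : Fin (n + 1) => Odd (k : ℕ)), π k a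

/-- The inclusion of the weighted projective space algebra into the lens space algebra. -/
noncomputable def toLens {n : ℕ} {q : ℝ} {p : Fin (n + 1) → ℕ}
    (a : weightedProj n q (sharp p)) : sharpLens n q p :=
  StarSubalgebra.inclusion (weightedProj_le_lens n q (∏ j, p j) (sharp p)) a

/-- The operator `π_+(a) - π_-(a)` for `a` in the weighted projective space algebra. -/
noncomputable def piDiff {n : ℕ} {q : ℝ} {p : Fin (n + 1) → ℕ}
    (π : Fin (n + 1) → (sharpLens n q p →⋆ₙₐ[ℂ] (Hn n →L[ℂ] Hn n)))
    (a : weightedProj n q (sharp p)) : Hn n →L[ℂ] Hn n :=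
  piPlus π (toLens a) - piMinus π (toLens a)

/-! ### Trace class operators and Fredholm modules -/

section Hilbert

universe u

variable {H : Type u} [NormedAddCommGroup H] [InnerProductSpace ℂ H] [CompleteSpace H]

/-- `T` is of trace class: `∑ ⟨e_i, |T| e_i⟩ < ∞` in orthonormal bases, with
`|T| = (T* T)^(1/2)`. -/
def IsTraceClass (T : H →L[ℂ] H) : Prop :=
  ∀ (ι : Type u) (b : HilbertBasis ι ℂ H),
    Summable fun i => (inner ℂ (b i) (CFC.abs T (b i))).re

/-- `τ` is the trace of `T`: `∑ ⟨e_i, T e_i⟩ = τ` in every orthonormal basis. -/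
def HasTrace (T : H →L[ℂ] H) (τ : ℂ) : Prop :=
  ∀ (ι : Type u) (b : HilbertBasis ι ℂ H),
    HasSum (fun i => inner ℂ (b i) (T (b i))) τ

/-- The operator `S ⊕ T` on the Hilbert space `H ⊕ H`. -/
noncomputable def directSum (S T : H →L[ℂ] H) : WithLp 2 (H × H) →L[ℂ] WithLp 2 (H × H) :=
  (WithLp.prodContinuousLinearEquiv 2 ℂ H H).symm ∘L (S.prodMap T) ∘L
    (WithLp.prodContinuousLinearEquiv 2 ℂ H H : WithLp 2 (H × H) →L[ℂ] H × H)

variable (H) in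
/-- The flip `v ⊕ w ↦ w ⊕ v`. -/
noncomputable def flipOp : WithLp 2 (H × H) →L[ℂ] WithLp 2 (H × H) :=
  (WithLp.prodContinuousLinearEquiv 2 ℂ H H).symm ∘L
    ((ContinuousLinearMap.snd ℂ H H).prod (ContinuousLinearMap.fst ℂ H H)) ∘L
    (WithLp.prodContinuousLinearEquiv 2 ℂ H H : WithLp 2 (H × H) →L[ℂ] H × H)

variable (H) in
/-- The grading `v ⊕ w ↦ v ⊕ (-w)`. -/
noncomputable def grading : WithLp 2 (H × H) →L[ℂ] WithLp 2 (H × H) := directSum 1 (-1)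

/-- `(A, H, π, F, γ)` is an even Fredholm module: `π` is a `*`-representation of the `*`-algebra
`A` by bounded operators on `H`, commuting with the grading `γ`, and `F` is an odd self-adjoint
unitary such that all commutators `[F, π a]` are compact. The representation is not required to
be nondegenerate. -/
structure IsEvenFredholmModule {A : Type*} [Ring A] [StarRing A] [Algebra ℂ A]
    (π : A → (H →L[ℂ] H)) (F γ : H →L[ℂ] H) : Prop where
  representation : ∃ ρ : A →⋆ₙₐ[ℂ] (H →L[ℂ] H), ∀ a, ρ a = π a
  F_selfAdjoint : IsSelfAdjoint F
  F_sq : F * F = 1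
  grading_selfAdjoint : IsSelfAdjoint γ
  grading_sq : γ * γ = 1
  F_odd : γ * F = -(F * γ)
  even : ∀ a, γ * π a = π a * γ
  compact : ∀ a, IsCompactOperator (F * π a - π a * F)

/-- An even Fredholm module is `1`-summable if all commutators `[F, π a]` are of trace class. -/
structure IsOneSummableEvenFredholmModule {A : Type*} [Ring A] [StarRing A] [Algebra ℂ A]
    (π : A → (H →L[ℂ] H)) (F γ : H →L[ℂ] H) : Prop extends IsEvenFredholmModule π F γ where
  traceClass : ∀ a, IsTraceClass (F * π a - π a * F)

end Hilbert

end QWP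

set_option linter.unusedSectionVars false

namespace QWP

/-! ### Nuclear operators -/

section Nuclear

open InnerProductSpace

variable {H K : Type*} [NormedAddCommGroup H] [InnerProductSpace ℂ H] [CompleteSpace H]
  [NormedAddCommGroup K] [InnerProductSpace ℂ K] [CompleteSpace K]

/-! Write S_i for κ_0 + ... + κ_{i-1}. Three ideas carry the proof.

Existence. The sphere algebra acts on ℓ²(ℕ^{n+1}), with basis vectors labelled by (κ_0, ..., κ_n):
for i < k the generator z_i raises κ_i by one, z_k is the diagonal operator q^{S_k}, and z_i = 0 for
i > k (`SphereRep.isSphereFamily_gen`). On the lens algebra only powers ζ_i = z_i^{p_i} occur, so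
the residues of κ_i mod p_i for i < k are preserved. Fixing them to be r_i, and treating m_{k+1},
..., m_n as spectators, embeds V_k as a subspace reducing for the lens algebra
(`commute_labelProj`); π_k is the compression to it. Uniqueness holds because x_i, ζ_i and ζ_i*
generate the lens algebra (`adjoin_lens`), where even the unit is a sum of the x_i.

Cancellation. If a basis vector |m⟩ lies in some V_k, then m rises weakly to a peak m_{j+1} and
falls strictly afterwards, and |m⟩ lies in exactly the two consecutive spaces V_j and V_{j+1}
(`InV.exists_peak`, `InV.eq_or_eq`). Hence the π_k with k of fixed parity are mutually orthogonal,
π_+ and π_- are representations, and π_+(a) - π_-(a) maps |m⟩ to ±(π_j(a) - π_{j+1}(a))|m⟩. On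
generators of the projective space algebra this difference is O(q^{m_{j+1}}) (`norm_x_sub_le`,
`norm_zeta_sub_le`). Since the peak dominates every coordinate, it is also O(s^{m_1+...+m_n}) with s
= q^{1/n} < 1, which is summable over ℕ^n.

Propagation. An operator whose values on an orthonormal basis have summable norms is nuclear, and
nuclear operators form a two-sided ideal closed under adjoints. The identity ρ_1(bc) - ρ_2(bc) =
ρ_1(b)(ρ_1(c) - ρ_2(c)) + (ρ_1(b) - ρ_2(b))ρ_2(c) extends nuclearity from generators to the whole
projective space algebra (`isNuclear_piDiff`). The generators are the x_i and the ζ_i ζ_j* with i ≠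
j (`adjoin_weightedProj`), found by normal ordering words and averaging over roots of unity. Nuclear
operators are compact and of trace class, and the commutator with F has ±(π_+(a) - π_-(a)) as its
off-diagonal entries. -/

/-- `T` is an absolutely convergent series of operators of rank one. -/
def IsNuclear (T : H →L[ℂ] K) : Prop :=
  ∃ (ι : Type) (u : ι → K) (v : ι → H),
    Summable (fun i => ‖u i‖ * ‖v i‖) ∧ HasSum (fun i => rankOne ℂ (u i) (v i)) T

namespace IsNuclear

theorem zero : IsNuclear (0 : H →L[ℂ] K) :=
  ⟨Empty, fun _ => 0, fun _ => 0, by simp, by simp⟩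

theorem add {S T : H →L[ℂ] K} (hS : IsNuclear S) (hT : IsNuclear T) : IsNuclear (S + T) := by
  obtain ⟨ι, u, v, h, hs⟩ := hS
  obtain ⟨κ, u', v', h', hs'⟩ := hT
  refine ⟨ι ⊕ κ, Sum.elim u u', Sum.elim v v', ?_, ?_⟩
  · exact (h.hasSum.sum (f := fun i => ‖Sum.elim u u' i‖ * ‖Sum.elim v v' i‖)
      h'.hasSum).summable
  · exact hs.sum (f := fun i => rankOne ℂ (Sum.elim u u' i) (Sum.elim v v' i)) hs'

theorem comp_left {L : Type*} [NormedAddCommGroup L] [InnerProductSpace ℂ L] [CompleteSpace L]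
    {T : H →L[ℂ] K} (hT : IsNuclear T) (A : K →L[ℂ] L) : IsNuclear (A ∘L T) := by
  obtain ⟨ι, u, v, h, hs⟩ := hT
  refine ⟨ι, fun i => A (u i), v, ?_, ?_⟩
  · refine Summable.of_nonneg_of_le (fun i => by positivity) (fun i => ?_) (h.mul_left ‖A‖)
    rw [← mul_assoc]
    gcongr
    exact A.le_opNorm _
  · have := (ContinuousLinearMap.compL ℂ H K L A).hasSum hs
    simpa [Function.comp_def, comp_rankOne] using this

theorem adjoint {T : H →L[ℂ] K} (hT : IsNuclear T) :
    IsNuclear (ContinuousLinearMap.adjoint T) := by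
  obtain ⟨ι, u, v, h, hs⟩ := hT
  refine ⟨ι, v, u, by simpa only [mul_comm] using h, ?_⟩
  have := hs.map ((ContinuousLinearMap.adjoint : (H →L[ℂ] K) ≃ₗᵢ⋆[ℂ] (K →L[ℂ] H)))
    (ContinuousLinearMap.adjoint : (H →L[ℂ] K) ≃ₗᵢ⋆[ℂ] (K →L[ℂ] H)).continuous
  simpa [Function.comp_def] using this

theorem comp_right {L : Type*} [NormedAddCommGroup L] [InnerProductSpace ℂ L] [CompleteSpace L]
    {T : H →L[ℂ] K} (hT : IsNuclear T) (A : L →L[ℂ] H) : IsNuclear (T ∘L A) := by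
  have := (hT.adjoint.comp_left (ContinuousLinearMap.adjoint A)).adjoint
  rwa [← ContinuousLinearMap.adjoint_comp, ContinuousLinearMap.adjoint_adjoint] at this

theorem smul {T : H →L[ℂ] K} (hT : IsNuclear T) (c : ℂ) : IsNuclear (c • T) := by
  simpa using hT.comp_left (c • ContinuousLinearMap.id ℂ K)

theorem neg {T : H →L[ℂ] K} (hT : IsNuclear T) : IsNuclear (-T) := by
  simpa using hT.smul (-1)

/-- The partial sums have finite rank and converge in operator norm. -/
theorem isCompactOperator {T : H →L[ℂ] K} (hT : IsNuclear T) : IsCompactOperator T := by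
  obtain ⟨ι, u, v, -, hs⟩ := hT
  refine isCompactOperator_of_tendsto hs (Filter.Eventually.of_forall fun s => ?_)
  refine (compactOperator (RingHom.id ℂ) H K).sum_mem (t := s)
    (f := fun i => ((rankOne ℂ (u i) (v i) : H →L[ℂ] K))) (fun i _ => ?_)
  change IsCompactOperator (rankOne ℂ (u i) (v i))
  rw [rankOne_def']
  exact (isCompactOperator_id (E := ℂ)).comp_clm (innerSL ℂ (v i)) |>.clm_comp
    (ContinuousLinearMap.toSpanSingleton ℂ (u i))

/-- An operator is nuclear if the norms of its values on a Hilbert basis are summable. -/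
theorem of_summable_norm {ι : Type} (b : HilbertBasis ι ℂ H) {T : H →L[ℂ] K}
    (h : Summable fun i => ‖T (b i)‖) : IsNuclear T := by
  have hb : ∀ i, ‖b i‖ = 1 := b.orthonormal.1
  -- Applying T to x = ∑ ⟨b_i, x⟩ b_i exhibits T as the sum of the rank one operators x ↦ ⟨b_i, x⟩ T
  -- b_i.
  refine ⟨ι, fun i => T (b i), b, by simpa [hb] using h, ?_⟩
  have hs : Summable fun i => rankOne ℂ (T (b i)) (b i) :=
    Summable.of_norm (by simpa [hb] using h)
  convert hs.hasSum
  ext x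
  have h1 := (ContinuousLinearMap.apply ℂ K x).hasSum hs.hasSum
  have h2 := T.hasSum (b.hasSum_repr x)
  refine h2.unique ?_
  simpa [Function.comp_def, b.repr_apply_apply] using h1

end IsNuclear

/-- Cauchy–Schwarz, then Bessel's inequality for each factor. The bound is uniform in the finite
set, as the double series of the trace requires. -/
theorem sum_norm_inner_mul_le {β : Type*} {b : β → H} (hb : Orthonormal ℂ b) (x y : H)
    (s : Finset β) : ∑ i ∈ s, ‖inner ℂ x (b i) * inner ℂ (b i) y‖ ≤ ‖x‖ * ‖y‖ := by
  simp only [norm_mul, norm_inner_symm x]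
  refine (Real.sum_mul_le_sqrt_mul_sqrt _ _ _).trans ?_
  gcongr <;>
  exact (Real.sqrt_le_left (by positivity)).2 (hb.sum_inner_products_le _)

namespace IsNuclear

/-- The double series ∑ ⟨v_i, b_j⟩⟨b_j, u_i⟩ converges absolutely. Summing over j first gives ∑
⟨v_i, u_i⟩ by Parseval, which does not depend on the basis; summing over i first gives ∑ ⟨b_j, T
b_j⟩. -/
theorem exists_hasTrace {T : H →L[ℂ] H} (hT : IsNuclear T) : ∃ τ : ℂ, HasTrace T τ := by
  obtain ⟨ι, u, v, h, hs⟩ := hT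
  refine ⟨∑' i, inner ℂ (v i) (u i), fun β b => ?_⟩
  have hsum : Summable fun x : ι × β => inner ℂ (v x.1) (b x.2) * inner ℂ (b x.2) (u x.1) := by
    refine Summable.of_norm ?_
    rw [summable_prod_of_nonneg fun _ => norm_nonneg _]
    have hle := fun i s => sum_norm_inner_mul_le b.orthonormal (v i) (u i) s
    have h1 : ∀ i, Summable fun j => ‖inner ℂ (v i) (b j) * inner ℂ (b j) (u i)‖ :=
      fun i => summable_of_sum_le (fun _ => norm_nonneg _) (hle i)
    refine ⟨h1, Summable.of_nonneg_of_le (fun i => tsum_nonneg fun _ => norm_nonneg _)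
      (fun i => ?_) h⟩
    rw [mul_comm]
    exact (h1 i).tsum_le_of_sum_le (hle i)
  have h1 := hsum.hasSum.prod_fiberwise fun i => b.hasSum_inner_mul_inner (v i) (u i)
  rw [h1.tsum_eq]
  have h2 := (Equiv.prodComm β ι).hasSum_iff.2 hsum.hasSum
  refine h2.prod_fiberwise fun j => ?_
  have h3 := (innerSL ℂ (b j)).hasSum ((ContinuousLinearMap.apply ℂ H (b j)).hasSum hs)
  simpa [Function.comp_def] using h3

/-- The absolute value of `T` factors through `T`. -/
theorem _root_.QWP.exists_abs_eq_comp (T : H →L[ℂ] H) :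
    ∃ W : H →L[ℂ] H, CFC.abs T = W ∘L T := by
  have hn : ∀ x, ‖CFC.abs T x‖ = ‖T x‖ := by
    intro x
    have h0 : IsSelfAdjoint (CFC.abs T) := (CFC.abs_nonneg T).isSelfAdjoint
    have h1 : inner ℂ (CFC.abs T x) (CFC.abs T x) = inner ℂ (T x) (T x) := by
      rw [← ContinuousLinearMap.adjoint_inner_right, ← ContinuousLinearMap.adjoint_inner_right,
        ← ContinuousLinearMap.star_eq_adjoint, ← ContinuousLinearMap.star_eq_adjoint, h0.star_eq]
      have := congrArg (fun S : H →L[ℂ] H => S x) (CFC.abs_mul_abs T)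
      exact congrArg (inner ℂ x) this
    rw [inner_self_eq_norm_sq_to_K, inner_self_eq_norm_sq_to_K] at h1
    have h3 : ‖CFC.abs T x‖ ^ 2 = ‖T x‖ ^ 2 := by exact_mod_cast h1
    exact (sq_eq_sq₀ (norm_nonneg _) (norm_nonneg _)).1 h3
  set R := (LinearMap.range T.toLinearMap).topologicalClosure with hR
  have : CompleteSpace R := (Submodule.isClosed_topologicalClosure _).completeSpace_coe
  let e : H →ₗ[ℂ] R := T.toLinearMap.codRestrict R fun x =>
    Submodule.le_topologicalClosure _ ⟨x, rfl⟩
  have hd : DenseRange e := by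
    intro y
    rw [closure_subtype]
    have : Subtype.val '' Set.range e = Set.range T := by
      ext z; simp [e, ← Set.range_comp, Function.comp_def]
    rw [this]
    exact y.2
  -- Half of the polar decomposition: as |T|x and Tx have equal norms, Tx ↦ |T|x is well defined and
  -- isometric on the range of T. It is extended to the closure by continuity, and by zero to the
  -- orthogonal complement.
  refine ⟨((CFC.abs T).toLinearMap.extendOfNorm e) ∘L R.orthogonalProjectionOnto, ?_⟩
  ext x
  have h1 : R.orthogonalProjectionOnto (T x) = e x :=
    R.orthogonalProjectionOnto_mem_subspace_eq_self (e x)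
  have h2 := LinearMap.extendOfNorm_eq (f := (CFC.abs T).toLinearMap) hd
    ⟨1, fun x => by simpa [e] using (hn x).le⟩ x
  simp only [ContinuousLinearMap.comp_apply, h1]
  exact h2.symm

/-- By the ideal property |T| = WT is nuclear as well, so its diagonal sums converge in every basis.
-/
theorem isTraceClass {T : H →L[ℂ] H} (hT : IsNuclear T) : IsTraceClass T := by
  intro ι b
  obtain ⟨W, hW⟩ := exists_abs_eq_comp T
  obtain ⟨τ, hτ⟩ := (hT.comp_left W).exists_hasTrace
  rw [hW]
  exact (Complex.hasSum_re (hτ ι b)).summable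

end IsNuclear

end Nuclear
end QWP

namespace QWP

/-! ### Commutation up to nonzero scalars -/

section QCommute

variable {A : Type*} [Ring A] [Algebra ℂ A]

/-- `a` and `b` commute up to a nonzero scalar. -/
def QCommute (a b : A) : Prop := ∃ c : ℂ, c ≠ 0 ∧ a * b = c • (b * a)

namespace QCommute

theorem symm {a b : A} (h : QCommute a b) : QCommute b a := by
  obtain ⟨c, hc, h⟩ := h
  exact ⟨c⁻¹, inv_ne_zero hc, by rw [h, inv_smul_smul₀ hc]⟩

theorem one_right (a : A) : QCommute a 1 := ⟨1, one_ne_zero, by simp⟩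

theorem mul_right {a b b' : A} (h : QCommute a b) (h' : QCommute a b') :
    QCommute a (b * b') := by
  obtain ⟨c, hc, h⟩ := h
  obtain ⟨c', hc', h'⟩ := h'
  refine ⟨c * c', mul_ne_zero hc hc', ?_⟩
  rw [← mul_assoc, h, smul_mul_assoc, mul_assoc, h', mul_smul_comm, smul_smul, mul_assoc]

theorem mul_left {a a' b : A} (h : QCommute a b) (h' : QCommute a' b) :
    QCommute (a * a') b :=
  (h.symm.mul_right h'.symm).symm

theorem pow_right {a b : A} (h : QCommute a b) (m : ℕ) : QCommute a (b ^ m) := by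
  induction m with
  | zero => simpa using one_right a
  | succ m ih => rw [pow_succ]; exact ih.mul_right h

theorem pow_left {a b : A} (h : QCommute a b) (m : ℕ) : QCommute (a ^ m) b :=
  (h.symm.pow_right m).symm

theorem star_star [StarRing A] [StarModule ℂ A] {a b : A} (h : QCommute a b) :
    QCommute (star a) (star b) := by
  obtain ⟨c, hc, h⟩ := h
  refine symm ⟨star c, star_ne_zero.2 hc, ?_⟩
  rw [← star_mul, h, star_smul, star_mul]

end QCommute

/-- The factor `a` is carried from the front to its slot `i`, collecting a nonzero scalar at each
factor it passes. Nothing is assumed about `a` and `g i`. -/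
theorem exists_mul_list_prod {ι : Type*} [DecidableEq ι] (g : ι → A) (a : A) (i : ι)
    (h : ∀ j, j ≠ i → QCommute a (g j)) (L : List ι) (hL : L.Nodup) (hi : i ∈ L) :
    ∃ c : ℂ, c ≠ 0 ∧ a * (L.map g).prod =
      c • (L.map (Function.update g i (a * g i))).prod := by
  induction L with
  | nil => simp at hi
  | cons j L ih =>
    rw [List.nodup_cons] at hL
    by_cases hj : j = i
    · subst hj
      refine ⟨1, one_ne_zero, ?_⟩
      have : L.map (Function.update g j (a * g j)) = L.map g :=
        List.map_congr_left fun k hk => Function.update_of_ne (by rintro rfl; exact hL.1 hk) _ _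
      simp [this, mul_assoc]
    · obtain ⟨c, hc, h1⟩ := ih hL.2 ((List.mem_cons.1 hi).resolve_left (Ne.symm hj))
      obtain ⟨d, hd, h2⟩ := h j hj
      refine ⟨d * c, mul_ne_zero hd hc, ?_⟩
      rw [List.map_cons, List.prod_cons, ← mul_assoc, h2, smul_mul_assoc, mul_assoc, h1,
        List.map_cons, List.prod_cons, Function.update_of_ne hj, mul_smul_comm, smul_smul]

/-- The elements `a` with `a X ⊆ X a`. -/
def leftNormalizer (X : Subalgebra ℂ A) : Submonoid A where
  carrier := {a | ∀ x ∈ X, ∃ y ∈ X, a * x = y * a}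
  one_mem' x hx := ⟨x, hx, by simp⟩
  mul_mem' {a b} ha hb x hx := by
    obtain ⟨y, hy, h1⟩ := hb x hx
    obtain ⟨w, hw, h2⟩ := ha y hy
    exact ⟨w, hw, by rw [mul_assoc, h1, ← mul_assoc, h2, mul_assoc]⟩

/-- The converse move: an element of `X` produced in the middle of an ordered product is brought
back to the front. It may change on the way, but stays in `X`. -/
theorem exists_list_prod_mul {ι : Type*} [DecidableEq ι] (X : Subalgebra ℂ A) (g : ι → A)
    (hg : ∀ j, g j ∈ leftNormalizer X) (i : ι) (x : A) (hx : x ∈ X) (L : List ι)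
    (hL : L.Nodup) (hi : i ∈ L) :
    ∃ y ∈ X, (L.map (Function.update g i (x * g i))).prod = y * (L.map g).prod := by
  induction L with
  | nil => simp at hi
  | cons j L ih =>
    rw [List.nodup_cons] at hL
    by_cases hj : j = i
    · subst hj
      refine ⟨x, hx, ?_⟩
      have : L.map (Function.update g j (x * g j)) = L.map g :=
        List.map_congr_left fun k hk => Function.update_of_ne (by rintro rfl; exact hL.1 hk) _ _
      simp [this, mul_assoc]
    · obtain ⟨y, hy, h1⟩ := ih hL.2 ((List.mem_cons.1 hi).resolve_left (Ne.symm hj))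
      obtain ⟨w, hw, h2⟩ := hg j y hy
      refine ⟨w, hw, ?_⟩
      rw [List.map_cons, List.prod_cons, h1, Function.update_of_ne hj, ← mul_assoc, h2,
        List.map_cons, List.prod_cons, mul_assoc]

end QCommute

/-! ### Normal ordering in the sphere algebra -/

namespace Sphere

variable {n : ℕ} {q : ℝ}

/-- The generator `z_i` or its adjoint. -/
noncomputable def letter (l : Fin (n + 1) × Bool) : Sphere n q :=
  if l.2 then star (z l.1) else z l.1

theorem qCommute_letter (hq : q ≠ 0) {l l' : Fin (n + 1) × Bool} (h : l.1 ≠ l'.1) :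
    QCommute (letter l : Sphere n q) (letter l') := by
  have hz := isSphereFamily_z (n := n) (q := q)
  have hqc : (q : ℂ) ≠ 0 := by exact_mod_cast hq
  have h1 : ∀ i j : Fin (n + 1), i ≠ j → QCommute (z i : Sphere n q) (z j) := by
    intro i j hij
    rcases lt_or_gt_of_ne hij with hij | hij
    · exact ⟨_, inv_ne_zero hqc, hz.gen_gen i j hij⟩
    · exact QCommute.symm ⟨_, inv_ne_zero hqc, hz.gen_gen j i hij⟩
  have h2 : ∀ i j : Fin (n + 1), i ≠ j → QCommute (star (z i) : Sphere n q) (z j) :=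
    fun i j hij => ⟨_, hqc, hz.star_gen i j hij⟩
  obtain ⟨i, b⟩ := l
  obtain ⟨j, b'⟩ := l'
  cases b <;> cases b'
  · exact h1 i j h
  · exact (h2 j i (Ne.symm h)).symm
  · exact h2 i j h
  · exact (h1 i j h).star_star

variable (n q) in
/-- The subalgebra generated by the `x_i = z_i z_i*`. -/
noncomputable def xAlg : Subalgebra ℂ (Sphere n q) :=
  Algebra.adjoin ℂ (Set.range fun i => z i * star (z i))

theorem x_mem_xAlg (i : Fin (n + 1)) : (z i * star (z i) : Sphere n q) ∈ xAlg n q :=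
  Algebra.subset_adjoin ⟨i, rfl⟩

theorem star_z_mul_z (i : Fin (n + 1)) : (star (z i) * z i : Sphere n q) =
    z i * star (z i) + (1 - (q : ℂ) ^ 2) • ∑ j ∈ Finset.Ioi i, z j * star (z j) := by
  rw [← isSphereFamily_z.commutator i]; abel

theorem star_z_mul_z_mem_xAlg (i : Fin (n + 1)) :
    (star (z i) * z i : Sphere n q) ∈ xAlg n q := by
  rw [star_z_mul_z]
  exact add_mem (x_mem_xAlg i) (Subalgebra.smul_mem _ (sum_mem fun j _ => x_mem_xAlg j) _)

/-- Letters commute with x_j up to a scalar when the indices differ. For equal indices, z_i* x_i =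
(z_i* z_i) z_i*, while z_i x_i is handled by rewriting x_i as z_i* z_i minus a combination of the
x_k with k > i. -/
theorem letter_mem_leftNormalizer (hq : q ≠ 0) (l : Fin (n + 1) × Bool) :
    (letter l : Sphere n q) ∈ leftNormalizer (xAlg n q) := by
  -- Being a submodule, `S` absorbs the sum of the x_k with k > i occurring in the commutator
  -- relation; closure under products is checked at the end.
  set S : Submodule ℂ (Sphere n q) :=
    { carrier := {x | ∃ y ∈ xAlg n q, letter l * x = y * letter l}
      add_mem' := by
        rintro a b ⟨y, hy, h⟩ ⟨y', hy', h'⟩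
        exact ⟨y + y', add_mem hy hy', by rw [mul_add, h, h', add_mul]⟩
      zero_mem' := ⟨0, zero_mem _, by simp⟩
      smul_mem' := by
        rintro c a ⟨y, hy, h⟩
        exact ⟨c • y, Subalgebra.smul_mem _ hy c, by rw [mul_smul_comm, h, smul_mul_assoc]⟩ }
    with hS
  have hne : ∀ j, j ≠ l.1 → z j * star (z j) ∈ S := by
    intro j hj
    obtain ⟨c, -, h⟩ := (qCommute_letter hq (l := l) (l' := (j, false)) (Ne.symm hj)).mul_right
      (qCommute_letter hq (l := l) (l' := (j, true)) (Ne.symm hj))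
    exact ⟨c • (z j * star (z j)), Subalgebra.smul_mem _ (x_mem_xAlg j) c, by
      rw [smul_mul_assoc]; exact h⟩
  have hgen : ∀ j, z j * star (z j) ∈ S := by
    intro j
    by_cases hj : j = l.1
    swap
    · exact hne j hj
    obtain ⟨i, b⟩ := l
    subst hj
    cases b
    · obtain ⟨y, hy, h⟩ : ∑ k ∈ Finset.Ioi j, z k * star (z k) ∈ S :=
        sum_mem fun k hk => hne k (Finset.mem_Ioi.1 hk).ne'
      refine ⟨z j * star (z j) - (1 - (q : ℂ) ^ 2) • y,
        sub_mem (x_mem_xAlg j) (Subalgebra.smul_mem _ hy _), ?_⟩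
      have h1 : (z j * star (z j) : Sphere n q) =
          star (z j) * z j - (1 - (q : ℂ) ^ 2) • ∑ k ∈ Finset.Ioi j, z k * star (z k) := by
        rw [star_z_mul_z]; abel
      change z j * (z j * star (z j)) = _ * z j
      change z j * _ = y * z j at h
      conv_lhs => rw [h1]
      rw [mul_sub, sub_mul, mul_smul_comm, h, smul_mul_assoc, mul_assoc]
    · exact ⟨star (z j) * z j, star_z_mul_z_mem_xAlg j, by simp [letter, mul_assoc]⟩
  intro x hx
  change x ∈ S
  refine Algebra.adjoin_induction (p := fun x _ => x ∈ S) ?_ ?_ ?_ ?_ hx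
  · rintro _ ⟨j, rfl⟩; exact hgen j
  · intro c
    exact ⟨algebraMap ℂ _ c, Subalgebra.algebraMap_mem _ c, (Algebra.commutes c _).symm⟩
  · exact fun a b _ _ => S.add_mem
  · rintro a b - - ⟨y, hy, h⟩ ⟨y', hy', h'⟩
    exact ⟨y * y', mul_mem hy hy', by rw [← mul_assoc, h, mul_assoc, h', mul_assoc]⟩

/-! ### Ordered monomials and the normal form of words -/

/-- The power `z_i ^ d` for `d ≥ 0` and `(z_i*) ^ (-d)` for `d < 0`. -/
noncomputable def zpw (i : Fin (n + 1)) (d : ℤ) : Sphere n q :=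
  if 0 ≤ d then z i ^ d.toNat else star (z i) ^ (-d).toNat

theorem zpw_natCast (i : Fin (n + 1)) (m : ℕ) : (zpw i m : Sphere n q) = z i ^ m := by
  simp [zpw]

theorem zpw_neg_natCast (i : Fin (n + 1)) (m : ℕ) :
    (zpw i (-m) : Sphere n q) = star (z i) ^ m := by
  rcases m with _ | m
  · simp [zpw]
  · rw [zpw, if_neg (by push_cast; omega)]; simp

theorem zpw_zero (i : Fin (n + 1)) : (zpw i 0 : Sphere n q) = 1 := by
  simp [zpw]

theorem qCommute_letter_zpw (hq : q ≠ 0) {l : Fin (n + 1) × Bool} {j : Fin (n + 1)}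
    (h : l.1 ≠ j) (d : ℤ) : QCommute (letter l : Sphere n q) (zpw j d) := by
  unfold zpw
  split_ifs
  · exact (qCommute_letter hq (l' := (j, false)) h).pow_right _
  · exact (qCommute_letter hq (l' := (j, true)) h).pow_right _

theorem zpw_mem_leftNormalizer (hq : q ≠ 0) (i : Fin (n + 1)) (d : ℤ) :
    (zpw i d : Sphere n q) ∈ leftNormalizer (xAlg n q) := by
  unfold zpw
  split_ifs
  · exact pow_mem (letter_mem_leftNormalizer hq (i, false)) _
  · exact pow_mem (letter_mem_leftNormalizer hq (i, true)) _

/-- The degree of a letter. -/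
def sgn (b : Bool) : ℤ := if b then -1 else 1

/-- When the letter and the power have opposite signs, z_i z_i* or z_i* z_i splits off on the left,
and both belong to `xAlg`; otherwise the exponent just grows in absolute value. -/
theorem letter_mul_zpw (i : Fin (n + 1)) (b : Bool) (d : ℤ) :
    ∃ x ∈ xAlg n q, letter (i, b) * zpw i d = x * zpw i (d + sgn b) := by
  cases b <;> obtain ⟨m, rfl | rfl⟩ := Int.eq_nat_or_neg d
  · refine ⟨1, one_mem _, ?_⟩
    change _ = _ * zpw i ((m : ℤ) + 1)
    rw [← Nat.cast_succ, zpw_natCast, zpw_natCast, pow_succ', one_mul]; rfl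
  · rcases m with _ | m
    · refine ⟨1, one_mem _, ?_⟩
      simpa [sgn, letter, zpw_zero] using (zpw_natCast i 1).symm
    · refine ⟨_, x_mem_xAlg i, ?_⟩
      have : -((m + 1 : ℕ) : ℤ) + sgn false = -(m : ℕ) := by simp [sgn]
      rw [this, zpw_neg_natCast, zpw_neg_natCast, pow_succ', ← mul_assoc]; rfl
  · rcases m with _ | m
    · refine ⟨1, one_mem _, ?_⟩
      simpa [sgn, letter, zpw_zero] using (zpw_neg_natCast i 1).symm
    · refine ⟨_, star_z_mul_z_mem_xAlg i, ?_⟩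
      have : ((m + 1 : ℕ) : ℤ) + sgn true = (m : ℕ) := by simp [sgn]
      rw [this, zpw_natCast, zpw_natCast, pow_succ', ← mul_assoc]; rfl
  · refine ⟨1, one_mem _, ?_⟩
    have : -(m : ℤ) + sgn true = -((m + 1 : ℕ) : ℤ) := by simp [sgn]; ring
    rw [this, zpw_neg_natCast, zpw_neg_natCast, pow_succ', one_mul]; rfl

/-- The ordered monomial of multidegree `d`. -/
noncomputable def mon (d : Fin (n + 1) → ℤ) : Sphere n q :=
  ((List.finRange (n + 1)).map fun i => zpw i (d i)).prod

/-- The product of a word in the letters. -/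
noncomputable def word (w : List (Fin (n + 1) × Bool)) : Sphere n q := (w.map letter).prod

/-- The multidegree of a word. -/
def deg (w : List (Fin (n + 1) × Bool)) (i : Fin (n + 1)) : ℤ :=
  (w.map fun l => if l.1 = i then sgn l.2 else 0).sum

theorem update_zpw (d : Fin (n + 1) → ℤ) (i : Fin (n + 1)) (c : ℤ) :
    (fun j => zpw j (Function.update d i c j)) =
      Function.update (fun j => (zpw j (d j) : Sphere n q)) i (zpw i c) := by
  ext j
  by_cases h : j = i
  · subst h; simp
  · simp [h]

/-- Induction on the word. The new first letter passes the coefficient, travels to its slot in the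
monomial and is absorbed there; the coefficient this creates returns to the front. Linear
independence of the monomials is never needed. -/
theorem word_eq (hq : q ≠ 0) (w : List (Fin (n + 1) × Bool)) :
    ∃ x ∈ xAlg n q, word w = x * mon (deg w) := by
  induction w with
  | nil => exact ⟨1, one_mem _, by simp [word, mon, deg, zpw_zero]⟩
  | cons l w ih =>
    obtain ⟨x, hx, h⟩ := ih
    obtain ⟨i, b⟩ := l
    obtain ⟨y, hy, h1⟩ := letter_mem_leftNormalizer hq (i, b) x hx
    have hL := List.nodup_finRange (n + 1)
    obtain ⟨c, -, h2⟩ := exists_mul_list_prod (fun j => (zpw j (deg w j) : Sphere n q))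
      (letter (i, b)) i (fun j hj => qCommute_letter_zpw hq (Ne.symm hj) _) _ hL
      (List.mem_finRange i)
    obtain ⟨u, hu, h3⟩ := letter_mul_zpw (q := q) i b (deg w i)
    have hd : deg ((i, b) :: w) = Function.update (deg w) i (deg w i + sgn b) := by
      ext j
      by_cases hj : j = i
      · subst hj; simp [deg, add_comm]
      · simp [deg, hj, Ne.symm hj]
    obtain ⟨v, hv, h4⟩ := exists_list_prod_mul (xAlg n q)
      (fun j => (zpw j (deg ((i, b) :: w) j) : Sphere n q))
      (fun j => zpw_mem_leftNormalizer hq _ _) i u hu _ hL (List.mem_finRange i)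
    refine ⟨y * (c • v), mul_mem hy (Subalgebra.smul_mem _ hv c), ?_⟩
    have h5 : Function.update (fun j => (zpw j (deg ((i, b) :: w) j) : Sphere n q)) i
        (u * zpw i (deg ((i, b) :: w) i)) =
        Function.update (fun j => (zpw j (deg w j) : Sphere n q)) i
          (letter (i, b) * zpw i (deg w i)) := by
      rw [h3, hd, update_zpw, Function.update_idem, Function.update_self]
    rw [h5] at h4
    change letter (i, b) * word w = _
    rw [h, ← mul_assoc, h1, mul_assoc, mul_assoc, smul_mul_assoc]
    congr 1
    change _ = c • (v * (List.map (fun j => zpw j (deg ((i, b) :: w) j)) _).prod)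
    rw [← h4, ← h2]; rfl

/-! ### Weights of words and invariant elements -/

/-- The weight of a word for the weighted action. -/
def wt (ℓ : Fin (n + 1) → ℕ) (w : List (Fin (n + 1) × Bool)) : ℤ := ∑ i, ℓ i * deg w i

theorem action_word (ℓ : Fin (n + 1) → ℕ) (t : Circle) (w : List (Fin (n + 1) × Bool)) :
    action ℓ t (word w : Sphere n q) = ((t ^ wt ℓ w : Circle) : ℂ) • word w := by
  induction w with
  | nil => simp [word, wt, deg]
  | cons l w ih =>
    obtain ⟨i, b⟩ := l
    have hw : wt ℓ ((i, b) :: w) = ℓ i * sgn b + wt ℓ w := by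
      simp [wt, deg, mul_add, Finset.sum_add_distrib]
    have hl : action ℓ t (letter (i, b) : Sphere n q) =
        ((t ^ (ℓ i * sgn b : ℤ) : Circle) : ℂ) • letter (i, b) := by
      cases b
      · simpa [letter, sgn] using action_z (q := q) ℓ t i
      · have := action_z (q := q) ℓ t i
        simp only [letter, sgn, if_true, map_star, this, star_smul]
        congr 1
        simp [← Circle.coe_inv_eq_conj]
    change action ℓ t (letter (i, b) * word w) = _ • (letter (i, b) * word w)
    rw [map_mul, hl, ih, smul_mul_smul_comm, hw, zpow_add, Circle.coe_mul]

theorem exists_eq_sum_word (a : Sphere n q) :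
    ∃ (F : Finset (List (Fin (n + 1) × Bool))) (c : List (Fin (n + 1) × Bool) → ℂ),
      a = ∑ w ∈ F, c w • word w := by
  have : a ∈ Submodule.span ℂ (Set.range (word : _ → Sphere n q)) := by
    obtain ⟨a, rfl⟩ := mk_surjective a
    refine MonoidAlgebra.induction_on (motive := fun a => mk a ∈ _) a (fun w => ?_) (fun a b ha hb => ?_) (fun c a ha => ?_)
    · refine Submodule.subset_span ⟨w.toList, ?_⟩
      have h1 : ∀ l, (mk (FreeStarAlg.letter l) : Sphere n q) = letter l := by
        rintro ⟨i, b⟩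
        cases b
        · rfl
        · exact (congrArg mk (FreeStarAlg.star_letter (i, false))).symm.trans (mk_star _)
      induction w with
      | one => rw [FreeMonoid.toList_one, map_one, map_one]; rfl
      | of l => exact (List.prod_singleton).trans (h1 l).symm
      | mul v w hv hw =>
        rw [FreeMonoid.toList_mul, map_mul, map_mul, ← hv, ← hw, word, List.map_append,
          List.prod_append]
        rfl
    · rw [map_add]; exact add_mem ha hb
    · rw [map_smul]; exact Submodule.smul_mem _ _ ha
  obtain ⟨c, rfl⟩ := (Finsupp.mem_span_range_iff_exists_finsupp).1 this
  exact ⟨c.support, c, rfl⟩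

/-- Words are eigenvectors of the action, so averaging over the N-th roots of unity removes those
whose weight is not a multiple of N and fixes the invariant element. -/
theorem eq_sum_filter_of_invariant (ℓ : Fin (n + 1) → ℕ) {N : ℕ} (hN : N ≠ 0)
    (F : Finset (List (Fin (n + 1) × Bool))) (c : List (Fin (n + 1) × Bool) → ℂ) (a : Sphere n q)
    (ha : a = ∑ w ∈ F, c w • word w) (h : ∀ t : Circle, t ^ N = 1 → action ℓ t a = a) :
    a = ∑ w ∈ F with (N : ℤ) ∣ wt ℓ w, c w • word w := by
  have hN' : (N : ℂ) ≠ 0 := by exact_mod_cast hN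
  set ω : Circle := Circle.exp (2 * Real.pi / N) with hω
  have hωc : (ω : ℂ) = Complex.exp (2 * Real.pi * Complex.I / N) := by
    rw [hω, Circle.coe_exp]; congr 1; push_cast; ring
  have hprim : IsPrimitiveRoot ω N := by
    have := Complex.isPrimitiveRoot_exp N hN
    rw [← hωc] at this
    exact IsPrimitiveRoot.of_map_of_injective (f := Circle.coeHom) this Subtype.coe_injective
  have hsum : ∀ m : ℤ, ∑ j ∈ Finset.range N, ((((ω ^ j) ^ m : Circle)) : ℂ) =
      if (N : ℤ) ∣ m then (N : ℂ) else 0 := by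
    intro m
    have h1 : ∀ j : ℕ, (((ω ^ j) ^ m : Circle) : ℂ) = ((ω ^ m : Circle) : ℂ) ^ j := by
      intro j
      rw [← Circle.coe_pow, ← zpow_natCast, ← zpow_natCast, ← zpow_mul, ← zpow_mul, mul_comm]
    simp only [h1]
    split_ifs with hm
    · rw [(hprim.zpow_eq_one_iff_dvd m).2 hm]; simp
    · have h2 : ((ω ^ m : Circle) : ℂ) ≠ 1 := fun h =>
        hm ((hprim.zpow_eq_one_iff_dvd m).1 (Circle.coe_eq_one.1 h))
      have h3 := mul_geom_sum ((ω ^ m : Circle) : ℂ) N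
      rw [← Circle.coe_pow, ← zpow_natCast, ← zpow_mul, mul_comm m, zpow_mul, zpow_natCast,
        hprim.pow_eq_one, one_zpow, Circle.coe_one, sub_self] at h3
      exact (mul_eq_zero.1 h3).resolve_left (sub_ne_zero.2 h2)
  have key : (N : ℂ) • a = (N : ℂ) • ∑ w ∈ F with (N : ℤ) ∣ wt ℓ w, c w • word w := by
    calc (N : ℂ) • a = ∑ j ∈ Finset.range N, action ℓ (ω ^ j) a := by
          rw [Finset.sum_congr rfl fun j _ => h (ω ^ j) (by
            rw [← pow_mul, mul_comm, pow_mul, hprim.pow_eq_one, one_pow])]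
          simp [Nat.cast_smul_eq_nsmul]
      _ = ∑ w ∈ F, c w • (∑ j ∈ Finset.range N, (((ω ^ j) ^ wt ℓ w : Circle) : ℂ)) • word w := by
          rw [ha]
          simp only [map_sum, map_smul, action_word, Finset.sum_smul, Finset.smul_sum]
          exact Finset.sum_comm
      _ = _ := by
          simp only [hsum, Finset.smul_sum, Finset.sum_filter]
          refine Finset.sum_congr rfl fun w _ => ?_
          split_ifs
          · rw [smul_comm]
          · simp
  exact smul_right_injective _ hN' key

/-- Modulo p_i all terms except ℓ_i d_i vanish, since p_i divides ℓ_j for j ≠ i; and ℓ_i is prime to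
p_i by pairwise coprimality. -/
theorem dvd_of_prod_dvd_wt {p : Fin (n + 1) → ℕ}
    (hcop : ∀ i j, i ≠ j → Nat.Coprime (p i) (p j)) {d : Fin (n + 1) → ℤ}
    (h : ((∏ j, p j : ℕ) : ℤ) ∣ ∑ i, (sharp p i : ℤ) * d i) (i : Fin (n + 1)) :
    (p i : ℤ) ∣ d i := by
  have h1 : (p i : ℤ) ∣ ∑ j, (sharp p j : ℤ) * d j :=
    (Int.natCast_dvd_natCast.2 (Finset.dvd_prod_of_mem p (Finset.mem_univ i))).trans h
  have h2 : (p i : ℤ) ∣ ∑ j ∈ Finset.univ.erase i, (sharp p j : ℤ) * d j := by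
    refine Finset.dvd_sum fun j hj => Dvd.dvd.mul_right (Int.natCast_dvd_natCast.2 ?_) _
    exact Finset.dvd_prod_of_mem p
      (Finset.mem_erase.2 ⟨(Finset.ne_of_mem_erase hj).symm, Finset.mem_univ i⟩)
  rw [← Finset.add_sum_erase _ _ (Finset.mem_univ i)] at h1
  have h3 := (dvd_add_left h2).1 h1
  refine IsCoprime.dvd_of_dvd_mul_left ?_ h3
  rw [Nat.isCoprime_iff_coprime]
  exact Nat.Coprime.prod_right fun j hj => hcop i j (Finset.ne_of_mem_erase hj).symm

theorem zpw_mul (i : Fin (n + 1)) (m : ℕ) (c : ℤ) : (zpw i (m * c) : Sphere n q) =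
    if 0 ≤ c then (z i ^ m) ^ c.toNat else (star (z i) ^ m) ^ (-c).toNat := by
  split_ifs with h
  · lift c to ℕ using h
    rw [← Nat.cast_mul, zpw_natCast, Int.toNat_natCast, pow_mul]
  · obtain ⟨k, hk⟩ := Int.eq_ofNat_of_zero_le (a := -c) (by omega)
    have : (m * c : ℤ) = -((m * k : ℕ) : ℤ) := by push_cast; rw [← hk]; ring
    rw [this, zpw_neg_natCast, hk, Int.toNat_natCast, pow_mul]

theorem mon_mem_of_zeta_mem {p : Fin (n + 1) → ℕ} (S : Subalgebra ℂ (Sphere n q))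
    (h : ∀ i, z i ^ p i ∈ S) (h' : ∀ i, star (z i) ^ p i ∈ S) (c : Fin (n + 1) → ℤ) :
    (mon (fun i => p i * c i) : Sphere n q) ∈ S := by
  refine S.list_prod_mem fun x hx => ?_
  obtain ⟨i, -, rfl⟩ := List.mem_map.1 hx
  rw [zpw_mul]
  split_ifs
  · exact pow_mem (h i) _
  · exact pow_mem (h' i) _

/-- Induction on ∑ |c_i|. A nonzero c with sum zero has a positive entry i and a negative entry j.
Up to a nonzero scalar, ζ_i ζ_j* splits off the monomial, and both entries move one step towards
zero. -/
theorem mon_mem_of_balanced (hq : q ≠ 0) {p : Fin (n + 1) → ℕ} (S : Subalgebra ℂ (Sphere n q))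
    (h : ∀ i j, i ≠ j → z i ^ p i * star (z j) ^ p j ∈ S) (N : ℕ) :
    ∀ (c : Fin (n + 1) → ℤ), ∑ i, c i = 0 → ∑ i, (c i).natAbs = N →
      (mon (fun i => p i * c i) : Sphere n q) ∈ S := by
  induction N using Nat.strong_induction_on with
  | _ N ih =>
  intro c hc hN
  by_cases h0 : c = 0
  · subst h0
    simp [mon, zpw_zero, one_mem]
  · obtain ⟨i, hi⟩ : ∃ i, 0 < c i := by
      by_contra! hneg
      exact h0 (funext fun i => (Finset.sum_eq_zero_iff_of_nonpos fun i _ => hneg i).1 hc i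
        (Finset.mem_univ i))
    obtain ⟨j, hj⟩ : ∃ j, c j < 0 := by
      by_contra! hpos
      exact h0 (funext fun i => (Finset.sum_eq_zero_iff_of_nonneg fun i _ => hpos i).1 hc i
        (Finset.mem_univ i))
    have hij : i ≠ j := by rintro rfl; omega
    have hL := List.nodup_finRange (n + 1)
    set c₁ := Function.update c i (c i - 1) with hc₁
    set c₂ := Function.update c₁ j (c j + 1) with hc₂
    -- Stated for general f because it serves twice: with the absolute value, to see the total
    -- degree drop, and with the identity, to see that the sum stays zero.
    have e1 : ∀ (f : ℤ → ℤ), ∑ k, f (c₂ k) = ∑ k, f (c k) - f (c i) + f (c i - 1)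
        - f (c j) + f (c j + 1) := by
      intro f
      have u : ∀ (d : Fin (n + 1) → ℤ) k x,
          ∑ l, f (Function.update d k x l) = ∑ l, f (d l) - f (d k) + f x := by
        intro d k x
        rw [← Finset.add_sum_erase _ _ (Finset.mem_univ k),
          ← Finset.add_sum_erase _ (fun l => f (d l)) (Finset.mem_univ k), Function.update_self,
          Finset.sum_congr rfl fun l hl => by
            rw [Function.update_of_ne (Finset.ne_of_mem_erase hl)]]
        ring
      rw [hc₂, u, hc₁, u, Function.update_of_ne hij.symm]
    have hs2 : (mon (fun i => p i * c₂ i) : Sphere n q) ∈ S := by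
      refine ih _ ?_ c₂ ?_ rfl
      · have := e1 (fun x => (x.natAbs : ℤ))
        rw [← hN]
        zify
        simp only [← Int.natCast_natAbs]
        rw [this]
        omega
      · have := e1 id
        simp only [id] at this
        rw [this, hc]; ring
    have hq1 : ∀ k, k ≠ j → QCommute (star (z j) ^ p j : Sphere n q) (zpw k (p k * c₂ k)) :=
      fun k hk => (qCommute_letter_zpw hq (l := (j, true)) (Ne.symm hk) _).pow_left _
    have hq2 : ∀ k, k ≠ i → QCommute (z i ^ p i : Sphere n q) (zpw k (p k * c₁ k)) :=
      fun k hk => (qCommute_letter_zpw hq (l := (i, false)) (Ne.symm hk) _).pow_left _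
    obtain ⟨a, ha, h1⟩ := exists_mul_list_prod _ _ j hq1 _ hL (List.mem_finRange j)
    obtain ⟨b, hb, h2⟩ := exists_mul_list_prod _ _ i hq2 _ hL (List.mem_finRange i)
    have f1 : Function.update (fun k => (zpw k (p k * c₂ k) : Sphere n q)) j
        (star (z j) ^ p j * zpw j (p j * c₂ j)) = fun k => zpw k (p k * c₁ k) := by
      ext k
      by_cases hk : k = j
      · subst hk
        obtain ⟨m, hm⟩ := Int.eq_ofNat_of_zero_le (a := -(c k + 1)) (by omega)
        have e2 : (p k * c₂ k : ℤ) = -((p k * m : ℕ) : ℤ) := by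
          rw [hc₂, Function.update_self]; push_cast; rw [← hm]; ring
        have e3 : (p k * c₁ k : ℤ) = -((p k + p k * m : ℕ) : ℤ) := by
          rw [hc₁, Function.update_of_ne hij.symm]; push_cast; rw [← hm]; ring
        rw [Function.update_self, e2, e3, zpw_neg_natCast, zpw_neg_natCast, pow_add]
      · rw [Function.update_of_ne hk, hc₂, Function.update_of_ne hk]
    have f2 : Function.update (fun k => (zpw k (p k * c₁ k) : Sphere n q)) i
        (z i ^ p i * zpw i (p i * c₁ i)) = fun k => zpw k (p k * c k) := by
      ext k
      by_cases hk : k = i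
      · subst hk
        obtain ⟨m, hm⟩ := Int.eq_ofNat_of_zero_le (a := c k - 1) (by omega)
        have e2 : (p k * c₁ k : ℤ) = ((p k * m : ℕ) : ℤ) := by
          rw [hc₁, Function.update_self]; push_cast; rw [← hm]
        have e3 : (p k * c k : ℤ) = ((p k + p k * m : ℕ) : ℤ) := by
          push_cast; rw [← hm]; ring
        rw [Function.update_self, e2, e3, zpw_natCast, zpw_natCast, pow_add]
      · rw [Function.update_of_ne hk, hc₁, Function.update_of_ne hk]
    rw [f1] at h1
    rw [f2] at h2
    have h3 : (z i ^ p i * star (z j) ^ p j) * mon (fun i => p i * c₂ i) =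
        (a * b) • (mon (fun i => p i * c i) : Sphere n q) := by
      simp only [mon]
      rw [mul_assoc, h1, mul_smul_comm, h2, smul_smul]
    have h4 := S.smul_mem (mul_mem (h i j hij) hs2) (a * b)⁻¹
    rwa [h3, inv_smul_smul₀ (mul_ne_zero ha hb)] at h4

end Sphere

/-! ### Generators of the invariant subalgebras -/

section Generators

variable {n : ℕ} {q : ℝ} {p : Fin (n + 1) → ℕ}

/-- This replaces unitality: a non-unital homomorphism is determined on scalars by its values on the
x_i. -/
theorem sum_lensX : ∑ i, (lensX p i : sharpLens n q p) = 1 := by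
  apply Subtype.ext
  rw [AddSubmonoidClass.coe_finsetSum]
  exact Sphere.isSphereFamily_z.sphere

/-- In an invariant element only words of weight divisible by the product of the p_j survive. By
coprimality their multidegrees are divisible by p_i in each slot, so their normal forms involve only
x_i, ζ_i and ζ_i*. -/
theorem adjoin_lens (hq : q ≠ 0) (hp : ∀ i, 0 < p i)
    (hcop : ∀ i j, i ≠ j → Nat.Coprime (p i) (p j)) :
    Algebra.adjoin ℂ (Set.range (lensX p) ∪ Set.range (lensZeta p) ∪
      Set.range (fun i => star (lensZeta p i)) : Set (sharpLens n q p)) = ⊤ := by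
  set G : Set (sharpLens n q p) := Set.range (lensX p) ∪ Set.range (lensZeta p) ∪
    Set.range (fun i => star (lensZeta p i)) with hG
  rw [eq_top_iff]
  rintro ⟨a, ha⟩ -
  let φ : sharpLens n q p →ₐ[ℂ] Sphere n q := (sharpLens n q p).toSubalgebra.val
  set S := (Algebra.adjoin ℂ G).map φ with hS
  have hX : Sphere.xAlg n q ≤ S := by
    refine Algebra.adjoin_le ?_
    rintro _ ⟨i, rfl⟩
    exact ⟨lensX p i, Algebra.subset_adjoin (Or.inl (Or.inl ⟨i, rfl⟩)), rfl⟩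
  have hZ : ∀ i, Sphere.z i ^ p i ∈ S := fun i =>
    ⟨lensZeta p i, Algebra.subset_adjoin (Or.inl (Or.inr ⟨i, rfl⟩)), rfl⟩
  have hZ' : ∀ i, star (Sphere.z i) ^ p i ∈ S := fun i =>
    ⟨star (lensZeta p i), Algebra.subset_adjoin (Or.inr ⟨i, rfl⟩), star_pow _ _⟩
  suffices h : a ∈ S by
    obtain ⟨b, hb, hba⟩ := h
    have : b = ⟨a, ha⟩ := Subtype.ext hba
    exact this ▸ hb
  obtain ⟨F, c, hF⟩ := Sphere.exists_eq_sum_word a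
  have hN : ∏ j, p j ≠ 0 := Finset.prod_ne_zero_iff.2 fun i _ => (hp i).ne'
  rw [Sphere.eq_sum_filter_of_invariant (sharp p) hN F c a hF (mem_lens.1 ha)]
  refine sum_mem fun w hw => S.smul_mem ?_ _
  obtain ⟨x, hx, h⟩ := Sphere.word_eq hq w
  choose d hd using Sphere.dvd_of_prod_dvd_wt hcop (Finset.mem_filter.1 hw).2
  have hd' : Sphere.deg w = fun i => p i * d i := funext hd
  rw [h, hd']
  exact mul_mem (hX hx) (Sphere.mon_mem_of_zeta_mem S hZ hZ' d)

/-- The element `x_i` of the weighted projective space algebra. -/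
noncomputable def projX (p : Fin (n + 1) → ℕ) (i : Fin (n + 1)) : weightedProj n q (sharp p) :=
  ⟨Sphere.z i * star (Sphere.z i), mem_weightedProj.2 fun t => by
    have h : ((t ^ sharp p i : Circle) : ℂ) * star ((t ^ sharp p i : Circle) : ℂ) = 1 := by
      rw [Complex.star_def, Complex.mul_conj, Circle.normSq_coe, Complex.ofReal_one]
    rw [map_mul, map_star, Sphere.action_z, star_smul, smul_mul_smul_comm, h, one_smul]⟩

/-- The element `ζ_i ζ_j*` of the weighted projective space algebra. -/
noncomputable def projZeta (p : Fin (n + 1) → ℕ) (i j : Fin (n + 1)) :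
    weightedProj n q (sharp p) :=
  ⟨Sphere.z i ^ p i * star (Sphere.z j ^ p j), mem_weightedProj.2 fun t => by
    have h : ∀ u : Circle, (u : ℂ) * star (u : ℂ) = 1 := fun u => by
      rw [Complex.star_def, Complex.mul_conj, Circle.normSq_coe, Complex.ofReal_one]
    have hz : ∀ k, Sphere.action (sharp p) t (Sphere.z k ^ p k : Sphere n q) =
        ((t ^ ∏ j, p j : Circle) : ℂ) • Sphere.z k ^ p k := fun k => by
      rw [map_pow, Sphere.action_z, smul_pow, ← Circle.coe_pow, ← pow_mul, sharp_mul]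
    rw [map_mul, map_star, hz, hz, star_smul, smul_mul_smul_comm, h, one_smul]⟩

theorem toLens_projX (i : Fin (n + 1)) :
    toLens (projX p i : weightedProj n q (sharp p)) = lensX p i := rfl

theorem toLens_projZeta (i j : Fin (n + 1)) :
    toLens (projZeta p i j : weightedProj n q (sharp p)) =
      lensZeta p i * star (lensZeta p j) := rfl

/-- As for the lens space, but now the weight is zero. Since ℓ_i p_i is the same for all i, the
reduced degrees d_i sum to zero, so the monomials are balanced. -/
theorem adjoin_weightedProj (hq : q ≠ 0) (hp : ∀ i, 0 < p i)
    (hcop : ∀ i j, i ≠ j → Nat.Coprime (p i) (p j)) :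
    Algebra.adjoin ℂ (Set.range (projX p) ∪ {a | ∃ i j, i ≠ j ∧ a = projZeta p i j} :
      Set (weightedProj n q (sharp p))) = ⊤ := by
  set G : Set (weightedProj n q (sharp p)) :=
    Set.range (projX p) ∪ {a | ∃ i j, i ≠ j ∧ a = projZeta p i j} with hG
  rw [eq_top_iff]
  rintro ⟨a, ha⟩ -
  let φ : weightedProj n q (sharp p) →ₐ[ℂ] Sphere n q :=
    (weightedProj n q (sharp p)).toSubalgebra.val
  set S := (Algebra.adjoin ℂ G).map φ with hS
  have hX : Sphere.xAlg n q ≤ S := by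
    refine Algebra.adjoin_le ?_
    rintro _ ⟨i, rfl⟩
    exact ⟨projX p i, Algebra.subset_adjoin (Or.inl ⟨i, rfl⟩), rfl⟩
  have hZ : ∀ i j, i ≠ j → Sphere.z i ^ p i * star (Sphere.z j) ^ p j ∈ S := fun i j hij =>
    ⟨projZeta p i j, Algebra.subset_adjoin (Or.inr ⟨i, j, hij, rfl⟩), by
      rw [← star_pow]; rfl⟩
  suffices h : a ∈ S by
    obtain ⟨b, hb, hba⟩ := h
    have : b = ⟨a, ha⟩ := Subtype.ext hba
    exact this ▸ hb
  obtain ⟨F, c, hF⟩ := Sphere.exists_eq_sum_word a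
  -- N exceeds the absolute value of every weight that occurs, so divisibility by N forces weight
  -- zero. Finite averages thus replace integration over U(1).
  rw [Sphere.eq_sum_filter_of_invariant (sharp p)
    (N := ∑ w ∈ F, (Sphere.wt (sharp p) w).natAbs + 1) (by omega) F c a hF
    fun t _ => mem_weightedProj.1 ha t]
  refine sum_mem fun w hw => S.smul_mem ?_ _
  obtain ⟨x, hx, h⟩ := Sphere.word_eq hq w
  have hw0 : Sphere.wt (sharp p) w = 0 := by
    refine Int.eq_zero_of_dvd_of_natAbs_lt_natAbs (Finset.mem_filter.1 hw).2 ?_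
    have := Finset.single_le_sum (f := fun w => (Sphere.wt (sharp p) w).natAbs)
      (fun _ _ => Nat.zero_le _) (Finset.mem_filter.1 hw).1
    simp only [Int.natAbs_natCast]
    omega
  choose d hd using Sphere.dvd_of_prod_dvd_wt hcop
    (show ((∏ j, p j : ℕ) : ℤ) ∣ ∑ i, (sharp p i : ℤ) * Sphere.deg w i from
      (dvd_zero _).trans (dvd_of_eq hw0.symm))
  have hd' : Sphere.deg w = fun i => p i * d i := funext hd
  have hsum : ∑ i, d i = 0 := by
    have h1 : ((∏ j, p j : ℕ) : ℤ) * ∑ i, d i = 0 := by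
      rw [← hw0, Sphere.wt, Finset.mul_sum]
      refine Finset.sum_congr rfl fun i _ => ?_
      rw [hd, ← sharp_mul p i]; push_cast; ring
    refine (mul_eq_zero.1 h1).resolve_left ?_
    exact_mod_cast Finset.prod_ne_zero_iff.2 fun i _ => (hp i).ne'
  rw [h, hd']
  exact mul_mem (hX hx) (Sphere.mon_mem_of_balanced hq S hZ _ d hsum rfl)

end Generators

end QWP

namespace QWP

/-! ### Operators on `ℓ²` given on the canonical basis -/

section EllTwo

variable {I J : Type*} [DecidableEq I] [DecidableEq J]

/-- The canonical basis vectors of `ℓ²(I)`. -/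
noncomputable def basisVec (i : I) : lp (fun _ : I => ℂ) 2 := lp.single 2 i (1 : ℂ)

variable (I) in
/-- The canonical Hilbert basis of `ℓ²(I)`. -/
noncomputable def basisEllTwo : HilbertBasis I ℂ (lp (fun _ : I => ℂ) 2) :=
  HilbertBasis.ofRepr (LinearIsometryEquiv.refl ℂ _)

theorem basisEllTwo_apply (i : I) : basisEllTwo I i = basisVec i :=
  (HilbertBasis.repr_symm_single (basisEllTwo I) i).symm

theorem orthonormal_basisVec : Orthonormal ℂ (basisVec : I → lp (fun _ : I => ℂ) 2) := by
  have := (basisEllTwo I).orthonormal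
  rwa [funext basisEllTwo_apply] at this

theorem inner_basisVec (i j : I) :
    inner ℂ (basisVec i) (basisVec j) = if i = j then (1 : ℂ) else 0 :=
  orthonormal_iff_ite.1 orthonormal_basisVec i j

theorem eq_of_inner_basisVec {x y : lp (fun _ : I => ℂ) 2}
    (h : ∀ i, inner ℂ (basisVec i) x = inner ℂ (basisVec i) y) : x = y := by
  apply (basisEllTwo I).repr.injective
  ext i
  rw [(basisEllTwo I).repr_apply_apply, (basisEllTwo I).repr_apply_apply, basisEllTwo_apply, h]

theorem clm_ext_basisVec {E : Type*} [NormedAddCommGroup E] [NormedSpace ℂ E]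
    {S T : lp (fun _ : I => ℂ) 2 →L[ℂ] E} (h : ∀ i, S (basisVec i) = T (basisVec i)) : S = T := by
  ext x
  have hx := (basisEllTwo I).hasSum_repr x
  refine (S.hasSum hx).unique ?_
  convert T.hasSum hx using 2 with i
  simp [basisEllTwo_apply, h]

/-- The isometry `|i⟩ ↦ |g i⟩`. -/
noncomputable def relabel (g : I → J) (hg : g.Injective) :
    lp (fun _ : I => ℂ) 2 →L[ℂ] lp (fun _ : J => ℂ) 2 :=
  ((orthonormal_basisVec.comp g hg).orthogonalFamily.linearIsometry).toContinuousLinearMap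

theorem relabel_basisVec (g : I → J) (hg : g.Injective) (i : I) :
    relabel g hg (basisVec i) = basisVec (g i) := by
  simp [relabel, basisVec, OrthogonalFamily.linearIsometry_apply_single]

open ContinuousLinearMap in
theorem adjoint_relabel_basisVec (g : I → J) (hg : g.Injective) (i : I) :
    adjoint (relabel g hg) (basisVec (g i)) = basisVec i := by
  refine eq_of_inner_basisVec fun j => ?_
  rw [adjoint_inner_right, relabel_basisVec, inner_basisVec, inner_basisVec]
  simp [hg.eq_iff]

open ContinuousLinearMap in
theorem adjoint_relabel_basisVec_of_notMem (g : I → J) (hg : g.Injective) {j : J}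
    (h : ∀ i, g i ≠ j) : adjoint (relabel g hg) (basisVec j) = 0 := by
  refine eq_of_inner_basisVec fun i => ?_
  rw [adjoint_inner_right, relabel_basisVec, inner_basisVec, if_neg (h i), inner_zero_right]

/-- The diagonal operator `|i⟩ ↦ c_i |i⟩`. -/
noncomputable def diag (c : I → ℝ) (hc : ∀ i, |c i| ≤ 1) :
    lp (fun _ : I => ℂ) 2 →L[ℂ] lp (fun _ : I => ℂ) 2 :=
  have hle : ∀ (f : lp (fun _ : I => ℂ) 2) i, ‖(c i : ℂ) * f i‖ ≤ ‖f i‖ := fun f i => by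
    rw [norm_mul, Complex.norm_real]
    exact mul_le_of_le_one_left (norm_nonneg _) (hc i)
  LinearMap.mkContinuous
    { toFun := fun f => ⟨fun i => (c i : ℂ) * f i, (lp.memℓp f).mono' (hle f)⟩
      map_add' := fun f g => by ext i; exact mul_add _ _ _
      map_smul' := fun a f => by ext i; simp; ring } 1 (fun f => by
        rw [one_mul]
        exact lp.norm_mono (by norm_num) (hle f))

theorem diag_basisVec (c : I → ℝ) (hc : ∀ i, |c i| ≤ 1) (i : I) :
    diag c hc (basisVec i) = (c i : ℂ) • basisVec i := by
  ext j
  change (c j : ℂ) * basisVec i j = (c i : ℂ) * basisVec i j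
  by_cases h : j = i
  · rw [h]
  · simp [basisVec, h]

open ContinuousLinearMap in
theorem adjoint_diag_basisVec (c : I → ℝ) (hc : ∀ i, |c i| ≤ 1) (i : I) :
    adjoint (diag c hc) (basisVec i) = (c i : ℂ) • basisVec i := by
  refine eq_of_inner_basisVec fun j => ?_
  rw [adjoint_inner_right, diag_basisVec, inner_smul_left, inner_smul_right, inner_basisVec,
    Complex.conj_ofReal]
  split_ifs with h
  · rw [h]
  · simp

end EllTwo
end QWP

namespace QWP

/-! ### The representations of the sphere algebra -/

theorem clm_mul_apply {H : Type*} [NormedAddCommGroup H] [NormedSpace ℂ H] (S T : H →L[ℂ] H)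
    (x : H) : (S * T) x = S (T x) := rfl

namespace SphereRep

open ContinuousLinearMap

variable {n : ℕ}

/-- The partial sum `κ_0 + ... + κ_{i-1}`. -/
def psum (κ : Fin (n + 1) → ℕ) (i : ℕ) : ℕ :=
  ∑ j ∈ Finset.univ.filter (fun j : Fin (n + 1) => (j : ℕ) < i), κ j

/-- The amount by which `z_i` shifts in the representation with index `k`. -/
def shift (k i : Fin (n + 1)) : Fin (n + 1) → ℕ := if i < k then Pi.single i 1 else 0

/-- The matrix coefficients of `z_i` in the representation with index `k`. -/
noncomputable def coeff (q : ℝ) (k i : Fin (n + 1)) (κ : Fin (n + 1) → ℕ) : ℝ :=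
  if i < k then q ^ psum κ i * √(1 - q ^ (2 * (κ i + 1)))
  else if i = k then q ^ psum κ i else 0

theorem psum_add_single (κ : Fin (n + 1) → ℕ) (i : Fin (n + 1)) (N j : ℕ) :
    psum (κ + Pi.single i N) j = psum κ j + if (i : ℕ) < j then N else 0 := by
  simp [psum, Finset.sum_add_distrib, Pi.single_apply]

theorem psum_succ (κ : Fin (n + 1) → ℕ) (i : Fin (n + 1)) :
    psum κ (i + 1) = psum κ i + κ i := by
  have : Finset.univ.filter (fun j : Fin (n + 1) => (j : ℕ) < i + 1) =
      insert i (Finset.univ.filter (fun j : Fin (n + 1) => (j : ℕ) < i)) := by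
    ext j; simp [Fin.ext_iff]; omega
  rw [psum, this, Finset.sum_insert (by simp), add_comm]; rfl

section

variable {q : ℝ} (hq0 : 0 < q) (hq1 : q < 1)

include hq0 hq1 in
theorem abs_coeff_le (k i : Fin (n + 1)) (κ : Fin (n + 1) → ℕ) : |coeff q k i κ| ≤ 1 := by
  have hp : ∀ N : ℕ, 0 ≤ q ^ N ∧ q ^ N ≤ 1 := fun N =>
    ⟨pow_nonneg hq0.le N, pow_le_one₀ hq0.le hq1.le⟩
  rw [coeff]
  split_ifs
  · rw [abs_of_nonneg (mul_nonneg (hp _).1 (Real.sqrt_nonneg _))]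
    refine mul_le_one₀ (hp _).2 (Real.sqrt_nonneg _) (Real.sqrt_le_one.2 ?_)
    linarith [(hp (2 * (κ i + 1))).1]
  · rw [abs_of_nonneg (hp _).1]; exact (hp _).2
  · simp

/-- For i < j, the coefficient of z_i depends only on κ_0, ..., κ_i, so the shift by z_j leaves it
alone, whereas the shift by z_i multiplies the coefficient of z_j by q. This asymmetry yields the
q-commutation of distinct generators. -/
theorem coeff_add_shift_of_lt {k i j : Fin (n + 1)} (h : i < j) (κ : Fin (n + 1) → ℕ) :
    coeff q k i (κ + shift k j) = coeff q k i κ := by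
  have h1 : psum (κ + shift k j) i = psum κ i := by
    unfold shift
    split_ifs
    · rw [psum_add_single, if_neg (by rw [not_lt]; exact h.le), add_zero]
    · rw [add_zero]
  have h2 : (κ + shift k j) i = κ i := by
    unfold shift
    split_ifs
    · simp [h.ne]
    · simp
  simp only [coeff, h1, h2]

theorem coeff_add_shift_of_gt {k i j : Fin (n + 1)} (h : i < j) (κ : Fin (n + 1) → ℕ) :
    coeff q k j (κ + shift k i) = q * coeff q k j κ := by
  rcases lt_or_ge k j with hkj | hkj
  · simp [coeff, hkj.not_gt, hkj.ne']
  have hi : i < k := h.trans_le hkj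
  have h1 : psum (κ + shift k i) j = psum κ j + 1 := by
    rw [shift, if_pos hi, psum_add_single, if_pos (Fin.lt_def.1 h)]
  have h2 : (κ + shift k i) j = κ j := by
    rw [shift, if_pos hi]; simp [h.ne']
  simp only [coeff, h1, h2]
  split_ifs <;> ring

/-- The operator by which `z_i` acts in the representation with index `k`. -/
noncomputable def gen (k i : Fin (n + 1)) : Hn (n + 1) →L[ℂ] Hn (n + 1) :=
  relabel (fun κ => κ + shift k i) (add_left_injective _) ∘L
    diag (coeff q k i) (abs_coeff_le hq0 hq1 k i)

theorem gen_ket (k i : Fin (n + 1)) (κ : Fin (n + 1) → ℕ) :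
    gen hq0 hq1 k i (ket κ) = (coeff q k i κ : ℂ) • ket (κ + shift k i) := by
  rw [gen, comp_apply, ket, ← basisVec, diag_basisVec, map_smul, relabel_basisVec]
  rfl

theorem star_gen_ket (k i : Fin (n + 1)) (κ : Fin (n + 1) → ℕ) :
    star (gen hq0 hq1 k i) (ket (κ + shift k i)) = (coeff q k i κ : ℂ) • ket κ := by
  rw [gen, star_eq_adjoint, ket, ket, ← basisVec, ← basisVec, adjoint_comp, comp_apply,
    adjoint_relabel_basisVec (fun κ => κ + shift k i) (add_left_injective _) κ,
    adjoint_diag_basisVec]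

theorem star_gen_ket_eq_zero {k i : Fin (n + 1)} (hi : i < k) {κ : Fin (n + 1) → ℕ}
    (h : κ i = 0) : star (gen hq0 hq1 k i) (ket κ) = 0 := by
  rw [gen, star_eq_adjoint, ket, ← basisVec, adjoint_comp, comp_apply,
    adjoint_relabel_basisVec_of_notMem, map_zero]
  intro κ' h'
  have := congrFun h' i
  simp [shift, hi] at this
  omega

/-- A basis vector is either in the range of the shift or annihilated by the adjoint of z_i;
computations with adjoints split accordingly. -/
theorem eq_add_shift_or (k i : Fin (n + 1)) (κ : Fin (n + 1) → ℕ) :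
    (∃ κ', κ = κ' + shift k i) ∨ (i < k ∧ κ i = 0) := by
  by_cases hi : i < k
  · rcases Nat.eq_zero_or_pos (κ i) with h | h
    · exact Or.inr ⟨hi, h⟩
    · refine Or.inl ⟨κ - Pi.single i 1, ?_⟩
      ext j
      by_cases hj : j = i
      · subst hj; simp [shift, hi]; omega
      · simp [shift, hi, hj]
  · exact Or.inl ⟨κ, by simp [shift, hi]⟩

/-- The sum of the eigenvalues of the `x_j`, `j ≥ i`. -/
noncomputable def tail (q : ℝ) (k : Fin (n + 1)) (κ : Fin (n + 1) → ℕ) (i : ℕ) : ℝ :=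
  if i ≤ k then q ^ (2 * psum κ i) else 0

include hq0 hq1 in
theorem one_sub_pow_nonneg (N : ℕ) : 0 ≤ 1 - q ^ N :=
  sub_nonneg.2 (pow_le_one₀ hq0.le hq1.le)

/-- Writing the eigenvalue of x_i as a difference of consecutive tails makes the commutator and
sphere relations telescope. -/
theorem gen_mul_star_ket (k i : Fin (n + 1)) (κ : Fin (n + 1) → ℕ) :
    (gen hq0 hq1 k i * star (gen hq0 hq1 k i)) (ket κ) =
      ((tail q k κ i - tail q k κ (i + 1) : ℝ) : ℂ) • ket κ := by
  rw [clm_mul_apply]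
  rcases eq_add_shift_or k i κ with ⟨κ, rfl⟩ | ⟨hi, h⟩
  · rw [star_gen_ket, map_smul, gen_ket, smul_smul, ← Complex.ofReal_mul]
    congr 2
    simp only [tail, coeff, psum_succ]
    rcases lt_trichotomy i k with hi | rfl | hi
    · have h1 : (i : ℕ) ≤ k := hi.le
      have h2 : (i : ℕ) + 1 ≤ k := hi
      simp only [hi, h1, h2, if_true, shift]
      rw [psum_add_single, if_neg (lt_irrefl _), add_zero]
      simp only [Pi.add_apply, Pi.single_eq_same]
      rw [mul_mul_mul_comm, Real.mul_self_sqrt (one_sub_pow_nonneg hq0 hq1 _)]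
      ring
    · simp [shift]; ring
    · have h1 : ¬ (i : ℕ) ≤ k := not_le.2 hi
      have h2 : ¬ (i : ℕ) + 1 ≤ k := by omega
      simp [h1, h2, hi.not_gt, hi.ne']
  · have h1 : (i : ℕ) ≤ k := hi.le
    have h2 : (i : ℕ) + 1 ≤ k := hi
    rw [star_gen_ket_eq_zero hq0 hq1 hi h, map_zero]
    simp [tail, h1, h2, psum_succ, h]

theorem star_gen_mul_ket (k i : Fin (n + 1)) (κ : Fin (n + 1) → ℕ) :
    (star (gen hq0 hq1 k i) * gen hq0 hq1 k i) (ket κ) =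
      ((tail q k κ i - tail q k κ (i + 1) + (1 - q ^ 2) * tail q k κ (i + 1) : ℝ) : ℂ) •
        ket κ := by
  rw [clm_mul_apply, gen_ket, map_smul, star_gen_ket, smul_smul, ← Complex.ofReal_mul]
  congr 2
  simp only [tail, coeff, psum_succ]
  rcases lt_trichotomy i k with hi | rfl | hi
  · have h1 : (i : ℕ) ≤ k := hi.le
    have h2 : (i : ℕ) + 1 ≤ k := hi
    simp only [hi, h1, h2, if_true]
    rw [mul_mul_mul_comm, Real.mul_self_sqrt (one_sub_pow_nonneg hq0 hq1 _)]
    ring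
  · simp; ring
  · have h1 : ¬ (i : ℕ) ≤ k := not_le.2 hi
    have h2 : ¬ (i : ℕ) + 1 ≤ k := by omega
    simp [h1, h2, hi.not_gt, hi.ne']

theorem clm_ext_ket {m : ℕ} {E : Type*} [NormedAddCommGroup E] [NormedSpace ℂ E]
    {S T : Hn m →L[ℂ] E} (h : ∀ κ, S (ket κ) = T (ket κ)) : S = T :=
  clm_ext_basisVec h

theorem tail_succ_n (k : Fin (n + 1)) (κ : Fin (n + 1) → ℕ) : tail q k κ (n + 1) = 0 := by
  have : ¬ n + 1 ≤ (k : ℕ) := by omega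
  simp [tail, this]

theorem isSphereFamily_gen (k : Fin (n + 1)) : Sphere.IsSphereFamily q (gen hq0 hq1 k) where
  gen_gen i j hij := by
    refine clm_ext_ket fun κ => ?_
    rw [clm_mul_apply, gen_ket, map_smul, gen_ket, smul_apply, clm_mul_apply, gen_ket, map_smul, gen_ket,
      smul_smul, smul_smul, smul_smul, coeff_add_shift_of_lt hij, coeff_add_shift_of_gt hij,
      add_right_comm]
    congr 1
    have : (q : ℂ) ≠ 0 := by exact_mod_cast hq0.ne'
    push_cast
    field_simp
  star_gen i j hij := by
    refine clm_ext_ket fun κ => ?_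
    rw [clm_mul_apply, gen_ket, map_smul, smul_apply, clm_mul_apply]
    rcases eq_add_shift_or k i κ with ⟨κ, rfl⟩ | ⟨hi, h⟩
    · rw [add_right_comm, star_gen_ket, star_gen_ket, map_smul, gen_ket, smul_smul, smul_smul,
        smul_smul]
      congr 1
      norm_cast
      rcases lt_or_gt_of_ne hij with h | h
      · rw [coeff_add_shift_of_lt h, coeff_add_shift_of_gt h]; ring
      · rw [coeff_add_shift_of_lt h, coeff_add_shift_of_gt h]; ring
    · rw [star_gen_ket_eq_zero hq0 hq1 hi h, star_gen_ket_eq_zero hq0 hq1 hi, smul_zero, map_zero,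
        smul_zero]
      have : shift k j i = 0 := by
        unfold shift
        split_ifs
        · exact Pi.single_eq_of_ne hij _
        · rfl
      simp [h, this]
  commutator i := by
    refine clm_ext_ket fun κ => ?_
    rw [sub_apply, star_gen_mul_ket, gen_mul_star_ket, smul_apply, sum_apply]
    simp only [gen_mul_star_ket]
    rw [← Finset.sum_smul, ← Complex.ofReal_sum]
    -- The sum telescopes; its upper end vanishes because the tail at n + 1 > k is zero by
    -- definition.
    have : ∑ j ∈ Finset.Ioi i, (tail q k κ j - tail q k κ (j + 1)) = tail q k κ (i + 1) := by
      have h1 := Finset.sum_map (Finset.Ioi i) Fin.valEmbedding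
        (fun j => tail q k κ j - tail q k κ (j + 1))
      have h2 : (Finset.Ioi i).map Fin.valEmbedding = Finset.Ico (i + 1 : ℕ) (n + 1) := by
        ext j
        simp only [Finset.mem_map, Finset.mem_Ioi, Fin.valEmbedding_apply, Finset.mem_Ico]
        constructor
        · rintro ⟨a, ha, rfl⟩; exact ⟨ha, a.2⟩
        · rintro ⟨h, h'⟩; exact ⟨⟨j, h'⟩, h, rfl⟩
      rw [h2] at h1
      refine h1.symm.trans ?_
      have h3 := Finset.sum_Ico_sub (tail q k κ) (m := i + 1) (n := n + 1) (by omega)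
      rw [tail_succ_n] at h3
      rw [← neg_inj, ← Finset.sum_neg_distrib]
      simpa using h3
    rw [this, ← sub_smul, smul_smul]
    congr 1
    push_cast
    ring
  sphere := by
    refine clm_ext_ket fun κ => ?_
    rw [sum_apply]
    simp only [gen_mul_star_ket]
    rw [← Finset.sum_smul, ← Complex.ofReal_sum,
      Fin.sum_univ_eq_sum_range (fun j => tail q k κ j - tail q k κ (j + 1)),
      Finset.sum_range_sub', tail_succ_n]
    simp [tail, psum]

/-- The representation of the sphere algebra with index `k`. -/
noncomputable def rep (k : Fin (n + 1)) : Sphere n q →⋆ₐ[ℂ] (Hn (n + 1) →L[ℂ] Hn (n + 1)) :=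
  Sphere.lift (gen hq0 hq1 k) (isSphereFamily_gen hq0 hq1 k)

theorem rep_z (k i : Fin (n + 1)) : rep hq0 hq1 k (Sphere.z i) = gen hq0 hq1 k i :=
  Sphere.lift_z _ _ _

theorem rep_x_ket (k i : Fin (n + 1)) (κ : Fin (n + 1) → ℕ) :
    rep hq0 hq1 k (Sphere.z i * star (Sphere.z i)) (ket κ) =
      ((tail q k κ i - tail q k κ (i + 1) : ℝ) : ℂ) • ket κ := by
  rw [map_mul, map_star, rep_z, gen_mul_star_ket]

theorem rep_pow_ket_of_lt {k i : Fin (n + 1)} (h : i < k) (N : ℕ) (κ : Fin (n + 1) → ℕ) :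
    rep hq0 hq1 k (Sphere.z i ^ N) (ket κ) =
      ((q ^ (N * psum κ i) * √(∏ s ∈ Finset.Ioc (κ i) (κ i + N), (1 - q ^ (2 * s))) : ℝ) : ℂ) •
        ket (κ + Pi.single i N) := by
  rw [map_pow, rep_z]
  induction N with
  | zero => simp
  | succ N ih =>
    rw [pow_succ', clm_mul_apply, ih, map_smul, gen_ket, smul_smul, ← Complex.ofReal_mul, add_assoc]
    have h1 : (Pi.single i N + shift k i : Fin (n + 1) → ℕ) = Pi.single i (N + 1) := by
      rw [shift, if_pos h, ← Pi.single_add]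
    rw [h1, coeff, if_pos h, psum_add_single, if_neg (lt_irrefl _), add_zero]
    simp only [Pi.add_apply, Pi.single_eq_same]
    rw [← add_assoc, ← Finset.insert_Ioc_right_eq_Ioc_add_one (by omega),
      Finset.prod_insert (by simp), Real.sqrt_mul (one_sub_pow_nonneg hq0 hq1 _)]
    congr 2
    ring

theorem rep_pow_ket_self (k : Fin (n + 1)) (N : ℕ) (κ : Fin (n + 1) → ℕ) :
    rep hq0 hq1 k (Sphere.z k ^ N) (ket κ) = ((q ^ (N * psum κ k) : ℝ) : ℂ) • ket κ := by
  rw [map_pow, rep_z]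
  induction N with
  | zero => simp
  | succ N ih =>
    rw [pow_succ', clm_mul_apply, ih, map_smul, gen_ket, smul_smul, ← Complex.ofReal_mul]
    simp only [shift, coeff, lt_irrefl, if_false, if_true, add_zero]
    congr 2
    ring

theorem gen_of_gt {k i : Fin (n + 1)} (h : k < i) : gen hq0 hq1 k i = 0 := by
  refine clm_ext_ket fun κ => ?_
  rw [gen_ket, coeff, if_neg h.not_gt, if_neg h.ne']
  simp

end

end SphereRep
end QWP

namespace QWP

/-! ### The index sets of the subspaces `V_k` -/

section Index

variable {n : ℕ}

theorem coord_add_eVec (m : Fin n → ℕ) (i : ℕ) {k : ℕ} (hk : k ≤ n) (j : ℕ) :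
    coord (m + eVec i k) j = coord m j + if i < j ∧ j ≤ k then 1 else 0 := by
  rcases j with _ | j
  · simp [coord]
  · by_cases hj : j < n
    · simp only [coord, hj, dif_pos, Pi.add_apply, eVec]
      congr 1
      simp only [Nat.lt_succ_iff, Nat.succ_le_iff]
    · have : ¬ (j + 1 ≤ k) := by omega
      simp [coord, hj, this]

theorem coord_injective {m m' : Fin n → ℕ} (h : ∀ j ≤ n, coord m j = coord m' j) : m = m' := by
  ext l
  have := h (l + 1) l.2
  simpa [coord] using this

theorem InV.add_eVec {k : Fin (n + 1)} {m : Fin n → ℕ} (h : InV k m) (i : ℕ) :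
    InV k (m + eVec i k) := by
  have hk : (k : ℕ) ≤ n := Nat.lt_succ_iff.1 k.2
  refine ⟨fun a b ha hab hb => ?_, fun a b ha hab hb => ?_⟩
  · have := h.1 a b ha hab hb
    rw [coord_add_eVec m i hk, coord_add_eVec m i hk]
    split_ifs <;> omega
  · have := h.2 a b ha hab hb
    rw [coord_add_eVec m i hk, coord_add_eVec m i hk]
    split_ifs <;> omega

/-- Strict growth at step i makes m_{i+1}, ..., m_k exceed m_i, so all of them can be lowered by one
without breaking monotonicity. Lowering m_k does not affect the descending block, which starts after
it. -/
theorem InV.exists_eq_add_eVec {k : Fin (n + 1)} {m : Fin n → ℕ} (h : InV k m) {i : ℕ}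
    (hi : i < k) (hlt : coord m i < coord m (i + 1)) : ∃ m', InV k m' ∧ m = m' + eVec i k := by
  have hk : (k : ℕ) ≤ n := Nat.lt_succ_iff.1 k.2
  have hpos : ∀ j, i < j → j ≤ k → coord m i < coord m j := fun j h1 h2 =>
    hlt.trans_le (h.1 (i + 1) j (by omega) h1 h2)
  obtain ⟨m', hm⟩ : ∃ m' : Fin n → ℕ, m = m' + eVec i k := by
    refine ⟨m - eVec i k, ?_⟩
    ext l
    simp only [Pi.add_apply, Pi.sub_apply, eVec]
    split_ifs with hl
    · have := hpos (l + 1) (by omega) (by omega)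
      simp [coord] at this
      omega
    · rfl
  refine ⟨m', ⟨fun a b ha hab hb => ?_, fun a b ha hab hb => ?_⟩, hm⟩
  · have h1 := h.1 a b ha hab hb
    have h2 := h.1 a i ha
    have h3 := hpos b
    rw [hm] at h1 h2 h3
    simp only [coord_add_eVec m' i hk] at h1 h2 h3
    split_ifs at h1 h2 h3 <;> omega
  · have h1 := h.2 a b ha hab hb
    rw [hm] at h1
    simp only [coord_add_eVec m' i hk] at h1
    split_ifs at h1 <;> omega

theorem InV.coord_le_succ {k : Fin (n + 1)} {m : Fin n → ℕ} (h : InV k m) {i : ℕ} (hi : i < k) :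
    coord m i ≤ coord m (i + 1) := by
  rcases i with _ | i
  · simp [coord]
  · exact h.1 _ _ (by omega) (by omega) hi

/-- The labels of the basis of the sphere representation: `κ_j` for `j < k`, and `m_{j+1}` for
`j ≥ k`, which are spectators. -/
def label (p : Fin (n + 1) → ℕ) (r : Fin n → ℕ) (k : Fin (n + 1)) (m : Fin n → ℕ)
    (j : Fin (n + 1)) : ℕ :=
  if h : j < k then kappa p r m ⟨j, lt_of_lt_of_le h (Nat.lt_succ_iff.1 k.2)⟩
  else coord m (j + 1)

variable {p : Fin (n + 1) → ℕ} {r : Fin n → ℕ}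

theorem kappa_mk (m : Fin n → ℕ) (j : Fin (n + 1)) (h : (j : ℕ) < n) :
    kappa p r m ⟨j, h⟩ = p j * (coord m (j + 1) - coord m j) + r ⟨j, h⟩ := rfl

theorem label_castSucc (m : Fin n → ℕ) {k : Fin (n + 1)} {i : Fin n} (h : i.castSucc < k) :
    label p r k m i.castSucc = kappa p r m i := by
  rw [label, dif_pos h]; rfl

theorem psum_label (k : Fin (n + 1)) (m : Fin n → ℕ) {i : ℕ} (hi : i ≤ k) :
    SphereRep.psum (label p r k m) i = kappaSum p r m i := by
  rw [SphereRep.psum, kappaSum, Finset.sum_filter, Finset.sum_filter, Fin.sum_univ_castSucc,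
    if_neg (by simp; omega), add_zero]
  refine Finset.sum_congr rfl fun j _ => ?_
  simp only [Fin.val_castSucc]
  split_ifs with h
  · exact label_castSucc m (Fin.lt_def.2 (by simp; omega))
  · rfl

/-- Starting from m_0 = 0, each m_{j+1} is recovered from κ_j and m_j while j < k; beyond that it is
itself a label. The last label is the default value `coord m (n + 1) = 0` and carries no
information. -/
theorem label_injOn (hp : ∀ i, 0 < p i) {k : Fin (n + 1)} {m m' : Fin n → ℕ} (hm : InV k m)
    (hm' : InV k m') (h : label p r k m = label p r k m') : m = m' := by
  have hk : (k : ℕ) ≤ n := Nat.lt_succ_iff.1 k.2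
  refine coord_injective fun j hj => ?_
  induction j with
  | zero => rfl
  | succ j ih =>
    have h1 := congrFun h ⟨j, by omega⟩
    have ih := ih (by omega)
    unfold label at h1
    split_ifs at h1 with hjk
    · rw [kappa_mk, kappa_mk] at h1
      have h2 := Nat.eq_of_mul_eq_mul_left (hp _) (Nat.add_right_cancel h1)
      have h3 := hm.coord_le_succ (i := j) hjk
      have h4 := hm'.coord_le_succ (i := j) hjk
      simp only at h2
      omega
    · exact h1

/-- Raising m_{i+1}, ..., m_k together changes just one difference below k, namely m_{i+1} - m_i.
Hence ζ_i, which raises κ_i by p_i, acts on V_k as the shift by this vector. -/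
theorem label_add_eVec {k i : Fin (n + 1)} (hi : i < k) {m : Fin n → ℕ} (hm : InV k m) :
    label p r k (m + eVec i k) = label p r k m + Pi.single i (p i) := by
  have hk : (k : ℕ) ≤ n := Nat.lt_succ_iff.1 k.2
  have hi' : (i : ℕ) < k := hi
  ext j
  simp only [label, Pi.add_apply, kappa_mk, coord_add_eVec m i hk]
  by_cases hjk : j < k
  · have hjk' : (j : ℕ) < k := hjk
    rw [dif_pos hjk, dif_pos hjk]
    have h1 := hm.coord_le_succ hjk'
    by_cases hij : j = i
    · subst hij
      rw [if_pos (by omega), if_neg (by omega), Pi.single_eq_same]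
      have : coord m (j + 1) + 1 - (coord m j + 0) = coord m (j + 1) - coord m j + 1 := by omega
      rw [this]; ring
    · have hij' : (j : ℕ) ≠ i := fun h => hij (Fin.ext h)
      rw [Pi.single_eq_of_ne hij, add_zero]
      congr 2
      split_ifs <;> omega
  · have hjk' : ¬ (j : ℕ) < k := hjk
    rw [dif_neg hjk, dif_neg hjk, if_neg (by omega), Pi.single_eq_of_ne (by rintro rfl; omega)]

/-- The bound r_i < p_i enters here: κ_i ≥ p_i rules out m_{i+1} = m_i, so the shift can be undone
inside V_k. Thus the complement of the set of labels is also stable under ζ_i. -/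
theorem exists_label_eq (hr : ∀ j : Fin n, r j < p j.castSucc) {k i : Fin (n + 1)} (hi : i < k)
    {m : Fin n → ℕ} (hm : InV k m) {κ : Fin (n + 1) → ℕ}
    (h : label p r k m = κ + Pi.single i (p i)) : ∃ m', InV k m' ∧ label p r k m' = κ := by
  have hk : (k : ℕ) ≤ n := Nat.lt_succ_iff.1 k.2
  have hi' : (i : ℕ) < k := hi
  have hlt : coord m i < coord m (i + 1) := by
    by_contra! hle
    have h1 := congrFun h i
    rw [label, dif_pos hi, kappa_mk, Nat.sub_eq_zero_of_le hle] at h1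
    have h2 : r ⟨i, _⟩ < p i := hr ⟨i, by omega⟩
    simp at h1
    omega
  obtain ⟨m', hm', rfl⟩ := hm.exists_eq_add_eVec hi' hlt
  rw [label_add_eVec hi hm'] at h
  exact ⟨m', hm', add_right_cancel h⟩

end Index

/-! ### Existence and uniqueness of the representations -/

section Block

open ContinuousLinearMap

variable {n : ℕ} {q : ℝ}

theorem basisVec_eq_ket {m : ℕ} (κ : Fin m → ℕ) : basisVec κ = ket κ := rfl

/-- The compression of a representation to an invariant subspace, given by a partial isometry. -/
noncomputable def compress {A H K : Type*} [NormedAddCommGroup H] [InnerProductSpace ℂ H]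
    [CompleteSpace H] [NormedAddCommGroup K] [InnerProductSpace ℂ K] [CompleteSpace K]
    [Ring A] [StarRing A] [Algebra ℂ A] (ρ : A →⋆ₐ[ℂ] (K →L[ℂ] K)) (V : H →L[ℂ] K)
    (hV : V ∘L adjoint V ∘L V = V) (hc : ∀ a, Commute (ρ a) (V ∘L adjoint V)) :
    A →⋆ₙₐ[ℂ] (H →L[ℂ] H) where
  toFun a := adjoint V ∘L ρ a ∘L V
  map_smul' c a := by ext x; simp
  map_zero' := by ext x; simp
  map_add' a b := by ext x; simp
  map_mul' a b := by
    ext x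
    have h1 : ∀ y, V (adjoint V (ρ b y)) = ρ b (V (adjoint V y)) := fun y =>
      (congrArg (fun S : K →L[ℂ] K => S y) (hc b).eq).symm
    have h2 : V (adjoint V (V x)) = V x := congrArg (fun S : H →L[ℂ] K => S x) hV
    change adjoint V (ρ (a * b) (V x)) = adjoint V (ρ a (V (adjoint V (ρ b (V x)))))
    rw [h1, h2, map_mul]; rfl
  map_star' a := by
    rw [map_star, star_eq_adjoint, star_eq_adjoint, adjoint_comp, adjoint_comp, adjoint_adjoint]
    rfl

variable {p : Fin (n + 1) → ℕ} {r : Fin n → ℕ}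

theorem label_subtype_injective (hp : ∀ i, 0 < p i) (k : Fin (n + 1)) :
    Function.Injective fun m : {m : Fin n → ℕ // InV k m} => label p r k m := fun m m' h =>
  Subtype.ext (label_injOn hp m.2 m'.2 h)

/-- The partial isometry mapping `|m⟩` to the basis vector labelled by `m`, for `m` in the index
set of `V_k`, and vanishing on the orthogonal complement of `V_k`. -/
noncomputable def labelMap (hp : ∀ i, 0 < p i) (r : Fin n → ℕ) (k : Fin (n + 1)) :
    Hn n →L[ℂ] Hn (n + 1) :=
  relabel (fun m : {m : Fin n → ℕ // InV k m} => label p r k m) (label_subtype_injective hp k) ∘L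
    adjoint (relabel (Subtype.val : {m : Fin n → ℕ // InV k m} → _) Subtype.val_injective)

variable (hp : ∀ i, 0 < p i) {k : Fin (n + 1)}

theorem labelMap_ket {m : Fin n → ℕ} (hm : InV k m) :
    labelMap hp r k (ket m) = ket (label p r k m) := by
  have h := adjoint_relabel_basisVec (Subtype.val : {m : Fin n → ℕ // InV k m} → _)
    Subtype.val_injective ⟨m, hm⟩
  rw [labelMap, comp_apply, ← basisVec_eq_ket, h, relabel_basisVec, basisVec_eq_ket]

theorem labelMap_ket_eq_zero {m : Fin n → ℕ} (hm : ¬ InV k m) :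
    labelMap hp r k (ket m) = 0 := by
  rw [labelMap, comp_apply, ← basisVec_eq_ket, adjoint_relabel_basisVec_of_notMem, map_zero]
  rintro ⟨m', hm'⟩ rfl
  exact hm hm'

theorem adjoint_labelMap_ket {m : Fin n → ℕ} (hm : InV k m) :
    adjoint (labelMap hp r k) (ket (label p r k m)) = ket m := by
  rw [labelMap, adjoint_comp, adjoint_adjoint, comp_apply, ← basisVec_eq_ket,
    adjoint_relabel_basisVec (fun m : {m : Fin n → ℕ // InV k m} => label p r k m) _ ⟨m, hm⟩,
    relabel_basisVec, basisVec_eq_ket]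

theorem adjoint_labelMap_ket_eq_zero {κ : Fin (n + 1) → ℕ}
    (hκ : ∀ m, InV k m → label p r k m ≠ κ) : adjoint (labelMap hp r k) (ket κ) = 0 := by
  rw [labelMap, adjoint_comp, adjoint_adjoint, comp_apply, ← basisVec_eq_ket,
    adjoint_relabel_basisVec_of_notMem, map_zero]
  exact fun m => hκ m m.2

theorem labelMap_comp_adjoint_comp :
    labelMap hp r k ∘L adjoint (labelMap hp r k) ∘L labelMap hp r k = labelMap hp r k := by
  refine SphereRep.clm_ext_ket fun m => ?_
  rw [comp_apply, comp_apply]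
  by_cases hm : InV k m
  · rw [labelMap_ket hp hm, adjoint_labelMap_ket hp hm, labelMap_ket hp hm]
  · rw [labelMap_ket_eq_zero hp hm, map_zero, map_zero]

theorem labelProj_ket (κ : Fin (n + 1) → ℕ) [Decidable (∃ m, InV k m ∧ label p r k m = κ)] :
    (labelMap hp r k ∘L adjoint (labelMap hp r k)) (ket κ) =
      if ∃ m, InV k m ∧ label p r k m = κ then ket κ else 0 := by
  rw [comp_apply]
  split_ifs with h
  · obtain ⟨m, hm, rfl⟩ := h
    rw [adjoint_labelMap_ket hp hm, labelMap_ket hp hm]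
  · rw [adjoint_labelMap_ket_eq_zero hp fun m hm h' => h ⟨m, hm, h'⟩, map_zero]

variable (hq0 : 0 < q) (hq1 : q < 1)

-- It suffices to test generators. Those acting diagonally preserve every set of labels, ζ_i with i
-- < k preserves the labels of V_k and their complement, and adjoints follow because the projection
-- is self-adjoint.
open Classical in
theorem commute_labelProj (hcop : ∀ i j, i ≠ j → Nat.Coprime (p i) (p j))
    (hr : ∀ j : Fin n, r j < p j.castSucc) (a : sharpLens n q p) :
    Commute (SphereRep.rep hq0 hq1 k a) (labelMap hp r k ∘L adjoint (labelMap hp r k)) := by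
  set P := labelMap hp r k ∘L adjoint (labelMap hp r k) with hP
  have hPs : star P = P := by rw [hP, star_eq_adjoint, adjoint_comp, adjoint_adjoint]
  have hPk := labelProj_ket (r := r) (k := k) hp
  rw [← hP] at hPk
  have hx : ∀ i, Commute (SphereRep.rep hq0 hq1 k (lensX p i : sharpLens n q p)) P := by
    intro i
    refine SphereRep.clm_ext_ket fun κ => ?_
    have := SphereRep.rep_x_ket hq0 hq1 k i κ
    change SphereRep.rep hq0 hq1 k (Sphere.z i * star (Sphere.z i)) (P (ket κ)) =
      P (SphereRep.rep hq0 hq1 k (Sphere.z i * star (Sphere.z i)) (ket κ))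
    rw [this, map_smul, hPk]
    split_ifs
    · rw [this]
    · simp
  have hz : ∀ i, Commute (SphereRep.rep hq0 hq1 k (lensZeta p i : sharpLens n q p)) P := by
    intro i
    rcases lt_trichotomy i k with hi | rfl | hi
    · refine SphereRep.clm_ext_ket fun κ => ?_
      have := SphereRep.rep_pow_ket_of_lt hq0 hq1 hi (p i) κ
      change SphereRep.rep hq0 hq1 k (Sphere.z i ^ p i) (P (ket κ)) =
        P (SphereRep.rep hq0 hq1 k (Sphere.z i ^ p i) (ket κ))
      rw [this, map_smul, hPk, hPk]
      have hiff : (∃ m, InV k m ∧ label p r k m = κ) ↔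
          ∃ m, InV k m ∧ label p r k m = κ + Pi.single i (p i) := by
        constructor
        · rintro ⟨m, hm, rfl⟩
          exact ⟨_, hm.add_eVec i, label_add_eVec hi hm⟩
        · rintro ⟨m, hm, h⟩
          exact exists_label_eq hr hi hm h
      simp only [hiff]
      split_ifs
      · rw [this]
      · simp
    · refine SphereRep.clm_ext_ket fun κ => ?_
      have := SphereRep.rep_pow_ket_self hq0 hq1 i (p i) κ
      change SphereRep.rep hq0 hq1 i (Sphere.z i ^ p i) (P (ket κ)) =
        P (SphereRep.rep hq0 hq1 i (Sphere.z i ^ p i) (ket κ))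
      rw [this, map_smul, hPk]
      split_ifs
      · rw [this]
      · simp
    · have : SphereRep.rep hq0 hq1 k (lensZeta p i : sharpLens n q p) = 0 := by
        change SphereRep.rep hq0 hq1 k (Sphere.z i ^ p i) = 0
        rw [map_pow, SphereRep.rep_z, SphereRep.gen_of_gt hq0 hq1 hi, zero_pow (hp i).ne']
      rw [this]; exact Commute.zero_left P
  have ha : a ∈ Algebra.adjoin ℂ (Set.range (lensX p) ∪ Set.range (lensZeta p) ∪
      Set.range (fun i => star (lensZeta p i)) : Set (sharpLens n q p)) := by
    rw [adjoin_lens hq0.ne' hp hcop]; trivial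
  refine Algebra.adjoin_induction (p := fun (b : sharpLens n q p) _ =>
    Commute (SphereRep.rep hq0 hq1 k b) P) ?_ ?_ ?_ ?_ ha
  · rintro _ ((⟨i, rfl⟩ | ⟨i, rfl⟩) | ⟨i, rfl⟩)
    · exact hx i
    · exact hz i
    · have := (hz i).star_star
      rwa [hPs, ← map_star] at this
  · intro c
    change Commute (SphereRep.rep hq0 hq1 k (algebraMap ℂ (Sphere n q) c)) P
    rw [AlgHomClass.commutes]
    exact Algebra.commute_algebraMap_left c P
  · intro b c _ _ hb hc
    change Commute (SphereRep.rep hq0 hq1 k ((b : Sphere n q) + c)) P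
    rw [map_add]; exact hb.add_left hc
  · intro b c _ _ hb hc
    change Commute (SphereRep.rep hq0 hq1 k ((b : Sphere n q) * c)) P
    rw [map_mul]; exact hb.mul_left hc

/-- The representation `π_k`. -/
noncomputable def blockRep (hcop : ∀ i j, i ≠ j → Nat.Coprime (p i) (p j))
    (hr : ∀ j : Fin n, r j < p j.castSucc) (k : Fin (n + 1)) :
    sharpLens n q p →⋆ₙₐ[ℂ] (Hn n →L[ℂ] Hn n) :=
  compress ((SphereRep.rep hq0 hq1 k).comp (sharpLens n q p).subtype) (labelMap hp r k)
    (labelMap_comp_adjoint_comp hp) (commute_labelProj hp hq0 hq1 hcop hr)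

theorem blockRep_apply (hcop : ∀ i j, i ≠ j → Nat.Coprime (p i) (p j))
    (hr : ∀ j : Fin n, r j < p j.castSucc) (k : Fin (n + 1)) (a : sharpLens n q p) (x : Hn n) :
    blockRep hp hq0 hq1 hcop hr k a x =
      adjoint (labelMap hp r k) (SphereRep.rep hq0 hq1 k a (labelMap hp r k x)) := rfl

theorem isBlockRep_blockRep (hcop : ∀ i j, i ≠ j → Nat.Coprime (p i) (p j))
    (hr : ∀ j : Fin n, r j < p j.castSucc) (k : Fin (n + 1)) :
    IsBlockRep p r k (blockRep (q := q) hp hq0 hq1 hcop hr k) where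
  x_gt i hi := by
    have : SphereRep.rep hq0 hq1 k (lensX p i : sharpLens n q p) = 0 := by
      change SphereRep.rep hq0 hq1 k (Sphere.z i * star (Sphere.z i)) = 0
      rw [map_mul, SphereRep.rep_z, SphereRep.gen_of_gt hq0 hq1 hi, zero_mul]
    ext1 x
    rw [blockRep_apply, this]; simp
  zeta_gt i hi := by
    have : SphereRep.rep hq0 hq1 k (lensZeta p i : sharpLens n q p) = 0 := by
      change SphereRep.rep hq0 hq1 k (Sphere.z i ^ p i) = 0
      rw [map_pow, SphereRep.rep_z, SphereRep.gen_of_gt hq0 hq1 hi, zero_pow (hp i).ne']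
    ext1 x
    rw [blockRep_apply, this]; simp
  x_off i m hm := by rw [blockRep_apply, labelMap_ket_eq_zero hp hm, map_zero, map_zero]
  zeta_off i m hm := by rw [blockRep_apply, labelMap_ket_eq_zero hp hm, map_zero, map_zero]
  x_lt i m hi hm := by
    have hi' : (i : ℕ) < k := hi
    have h := SphereRep.rep_x_ket hq0 hq1 k i.castSucc (label p r k m)
    rw [blockRep_apply, labelMap_ket hp hm]
    refine (congrArg _ h).trans ?_
    rw [map_smul, adjoint_labelMap_ket hp hm]
    congr 2
    have h1 := SphereRep.psum_succ (label p r k m) i.castSucc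
    rw [label_castSucc m hi, Fin.val_castSucc, psum_label k m hi'.le] at h1
    rw [SphereRep.tail, SphereRep.tail, Fin.val_castSucc, if_pos hi'.le,
      if_pos (Nat.succ_le_iff.2 hi'), h1, psum_label k m hi'.le]
    ring
  x_self m hm := by
    have h := SphereRep.rep_x_ket hq0 hq1 k k (label p r k m)
    rw [blockRep_apply, labelMap_ket hp hm]
    refine (congrArg _ h).trans ?_
    rw [map_smul, adjoint_labelMap_ket hp hm]
    congr 2
    rw [SphereRep.tail, SphereRep.tail, if_pos le_rfl, if_neg (by omega), sub_zero,
      psum_label k m le_rfl]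
  zeta_lt i m hi hm := by
    have hi' : (i : ℕ) < k := hi
    have h := SphereRep.rep_pow_ket_of_lt hq0 hq1 hi (p i.castSucc) (label p r k m)
    rw [blockRep_apply, labelMap_ket hp hm]
    refine (congrArg _ h).trans ?_
    rw [map_smul, ← label_add_eVec hi hm, adjoint_labelMap_ket hp (hm.add_eVec _),
      label_castSucc m hi, Fin.val_castSucc, psum_label k m hi'.le]
  zeta_self m hm := by
    have h := SphereRep.rep_pow_ket_self hq0 hq1 k (p k) (label p r k m)
    rw [blockRep_apply, labelMap_ket hp hm]
    refine (congrArg _ h).trans ?_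
    rw [map_smul, adjoint_labelMap_ket hp hm, psum_label k m le_rfl]

-- The prescribed values fix π on x_i and ζ_i, hence on ζ_i*, and on scalars through 1 = ∑ x_i.
include hp hq0 in
theorem IsBlockRep.ext (hcop : ∀ i j, i ≠ j → Nat.Coprime (p i) (p j))
    {π π' : sharpLens n q p →⋆ₙₐ[ℂ] (Hn n →L[ℂ] Hn n)} (h : IsBlockRep p r k π)
    (h' : IsBlockRep p r k π') : π' = π := by
  have hx : ∀ i, π' (lensX p i) = π (lensX p i) := by
    intro i
    rcases lt_trichotomy i k with hi | rfl | hi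
    · obtain ⟨j, rfl⟩ := Fin.exists_castSucc_eq.2 (Fin.ne_last_of_lt hi)
      refine SphereRep.clm_ext_ket fun m => ?_
      by_cases hm : InV k m
      · rw [h.x_lt j m hi hm, h'.x_lt j m hi hm]
      · rw [h.x_off _ m hm, h'.x_off _ m hm]
    · refine SphereRep.clm_ext_ket fun m => ?_
      by_cases hm : InV i m
      · rw [h.x_self m hm, h'.x_self m hm]
      · rw [h.x_off _ m hm, h'.x_off _ m hm]
    · rw [h.x_gt i hi, h'.x_gt i hi]
  have hz : ∀ i, π' (lensZeta p i) = π (lensZeta p i) := by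
    intro i
    rcases lt_trichotomy i k with hi | rfl | hi
    · obtain ⟨j, rfl⟩ := Fin.exists_castSucc_eq.2 (Fin.ne_last_of_lt hi)
      refine SphereRep.clm_ext_ket fun m => ?_
      by_cases hm : InV k m
      · rw [h.zeta_lt j m hi hm, h'.zeta_lt j m hi hm]
      · rw [h.zeta_off _ m hm, h'.zeta_off _ m hm]
    · refine SphereRep.clm_ext_ket fun m => ?_
      by_cases hm : InV i m
      · rw [h.zeta_self m hm, h'.zeta_self m hm]
      · rw [h.zeta_off _ m hm, h'.zeta_off _ m hm]
    · rw [h.zeta_gt i hi, h'.zeta_gt i hi]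
  ext1 a
  have ha : a ∈ Algebra.adjoin ℂ (Set.range (lensX p) ∪ Set.range (lensZeta p) ∪
      Set.range (fun i => star (lensZeta p i)) : Set (sharpLens n q p)) := by
    rw [adjoin_lens hq0.ne' hp hcop]; trivial
  refine Algebra.adjoin_induction (p := fun (b : sharpLens n q p) _ => π' b = π b) ?_ ?_ ?_ ?_ ha
  · rintro _ ((⟨i, rfl⟩ | ⟨i, rfl⟩) | ⟨i, rfl⟩)
    · exact hx i
    · exact hz i
    · rw [map_star, map_star, hz]
  · intro c
    rw [Algebra.algebraMap_eq_smul_one, ← sum_lensX, map_smul, map_smul, map_sum, map_sum]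
    simp only [hx]
  · intro b c _ _ hb hc
    rw [map_add, map_add, hb, hc]
  · intro b c _ _ hb hc
    rw [map_mul, map_mul, hb, hc]

end Block
end QWP

namespace QWP

/-! ### Comparison of consecutive representations -/

section Compare

open ContinuousLinearMap

variable {n : ℕ} {q : ℝ} {p : Fin (n + 1) → ℕ} {r : Fin n → ℕ}

/-- At the end of the rising block either m_k ≤ m_{k+1}, and the peak is m_{k+1}, or the descent
already begins at m_k, which is then the peak. -/
theorem InV.exists_peak (hn : 1 ≤ n) {k : Fin (n + 1)} {m : Fin n → ℕ} (h : InV k m) :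
    ∃ j : Fin n, InV j.castSucc m ∧ InV j.succ m := by
  have hk : (k : ℕ) ≤ n := Nat.lt_succ_iff.1 k.2
  by_cases hup : (k : ℕ) < n ∧ coord m k ≤ coord m (k + 1)
  · refine ⟨⟨k, hup.1⟩, h, fun a b ha hab hb => ?_, fun a b ha hab hb => ?_⟩
    · simp only [Fin.succ_mk] at hb
      rcases Nat.lt_or_ge k b with hb' | hb'
      · obtain rfl : b = k + 1 := by omega
        rcases Nat.lt_or_ge k a with ha' | ha'
        · obtain rfl : a = k + 1 := by omega
          rfl
        · exact (h.1 a k ha ha' le_rfl).trans hup.2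
      · exact h.1 a b ha hab hb'
    · simp only [Fin.succ_mk] at ha
      exact h.2 a b (by omega) hab hb
  -- For k = 0 the convention m_0 = 0 ≤ m_1 places us in the first alternative; this needs n ≥ 1.
  · have hk0 : 0 < (k : ℕ) := by
      by_contra hk0
      have : (k : ℕ) = 0 := by omega
      rw [this] at hup
      exact hup ⟨hn, by simp [coord]⟩
    have hs : (⟨k - 1, by omega⟩ : Fin n).succ = k := Fin.ext (by simp; omega)
    refine ⟨⟨k - 1, by omega⟩, ⟨fun a b ha hab hb => ?_, fun a b ha hab hb => ?_⟩, by rwa [hs]⟩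
    · simp at hb
      exact h.1 a b ha hab (by omega)
    · simp at ha
      rcases Nat.lt_or_ge k a with ha' | ha'
      · exact h.2 a b ha' hab hb
      · obtain rfl : a = k := by omega
        have h1 : coord m (k + 1) < coord m k := by
          by_contra! hle
          exact hup ⟨by omega, hle⟩
        rcases Nat.lt_or_ge (k + 1) b with hb' | hb'
        · exact (h.2 (k + 1) b (by omega) hb' hb).trans h1
        · obtain rfl : b = k + 1 := by omega
          exact h1

/-- A smaller k would force m_j > m_{j+1}, and a larger one m_{j+1} ≤ m_{j+2}. Weak ascent against
strict descent makes the peak unique. -/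
theorem InV.eq_or_eq {k : Fin (n + 1)} {m : Fin n → ℕ} {j : Fin n} (h1 : InV j.castSucc m)
    (h2 : InV j.succ m) (h : InV k m) : k = j.castSucc ∨ k = j.succ := by
  have hk : (k : ℕ) ≤ n := Nat.lt_succ_iff.1 k.2
  have hj := j.2
  simp only [Fin.ext_iff, Fin.val_castSucc, Fin.val_succ]
  by_contra! hne
  rcases Nat.lt_or_ge k j with hkj | hkj
  · have e1 := h.2 j (j + 1) hkj (by omega) (by omega)
    have e2 := h2.1 j (j + 1) (by omega) (by omega) (by simp)
    omega
  · have e1 := h.1 (j + 1) (j + 2) (by omega) (by omega) (by omega)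
    have e2 := h1.2 (j + 1) (j + 2) (by simp) (by omega) (by omega)
    omega

theorem InV.coord_le_peak {m : Fin n → ℕ} {j : Fin n} (h1 : InV j.castSucc m)
    (h2 : InV j.succ m) (l : Fin n) : m l ≤ coord m (j + 1) := by
  have hl : m l = coord m (l + 1) := by simp [coord]
  have hj := j.2
  rw [hl]
  rcases Nat.lt_or_ge j l with h | h
  · exact (h1.2 (j + 1) (l + 1) (by simp) (by omega) (by omega)).le
  · exact h2.1 (l + 1) (j + 1) (by omega) (by omega) (by simp)

/-! ### Bounds for the matrix coefficients -/

theorem kappa_congr {m m' : Fin n → ℕ} {j : Fin n} (h : coord m j = coord m' j)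
    (h' : coord m (j + 1) = coord m' (j + 1)) : kappa p r m j = kappa p r m' j := by
  rw [kappa, kappa, h, h']

theorem kappaSum_congr {m m' : Fin n → ℕ} {i : ℕ} (h : ∀ a ≤ i, coord m a = coord m' a) :
    kappaSum p r m i = kappaSum p r m' i := by
  refine Finset.sum_congr rfl fun j hj => ?_
  have := (Finset.mem_filter.1 hj).2
  exact kappa_congr (h _ (by omega)) (h _ (by omega))

theorem kappaSum_succ (m : Fin n → ℕ) (j : Fin n) :
    kappaSum p r m (j + 1) = kappaSum p r m j + kappa p r m j := by
  have : Finset.univ.filter (fun i : Fin n => (i : ℕ) < j + 1) =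
      insert j (Finset.univ.filter (fun i : Fin n => (i : ℕ) < j)) := by
    ext i; simp [Fin.ext_iff]; omega
  rw [kappaSum, this, Finset.sum_insert (by simp), add_comm]; rfl

/-- Because p_j ≥ 1, κ_j is at least m_{j+1} - m_j, and these increments telescope. Powers of q in
S_{j+1} are thereby controlled by the peak. -/
theorem coord_le_kappaSum (hp : ∀ i, 0 < p i) (m : Fin n → ℕ) {i : ℕ} (hi : i ≤ n) :
    coord m i ≤ kappaSum p r m i := by
  induction i with
  | zero => simp [coord]
  | succ i ih =>
    have h1 := kappaSum_succ (p := p) (r := r) m ⟨i, hi⟩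
    have h2 := Nat.le_mul_of_pos_left (coord m (i + 1) - coord m i)
      (hp (⟨i, hi⟩ : Fin n).castSucc)
    have h3 := ih (by omega)
    simp only [kappa] at h1
    omega

/-- The matrix coefficients of `ζ_i`. -/
noncomputable def zetaCoeff (q : ℝ) (p : Fin (n + 1) → ℕ) (r : Fin n → ℕ) (m : Fin n → ℕ)
    (i : Fin n) : ℝ :=
  q ^ (p i.castSucc * kappaSum p r m i) *
    √(∏ s ∈ Finset.Ioc (kappa p r m i) (kappa p r m i + p i.castSucc), (1 - q ^ (2 * s)))

theorem zetaCoeff_congr {m m' : Fin n → ℕ} {i : Fin n}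
    (h : ∀ a ≤ (i : ℕ) + 1, coord m a = coord m' a) :
    zetaCoeff q p r m i = zetaCoeff q p r m' i := by
  rw [zetaCoeff, zetaCoeff, kappa_congr (h _ (by omega)) (h _ le_rfl),
    kappaSum_congr fun a ha => h a (by omega)]

theorem prod_mem_unitInterval (hq0 : 0 < q) (hq1 : q < 1) (s : Finset ℕ) :
    0 ≤ ∏ a ∈ s, (1 - q ^ (2 * a)) ∧ ∏ a ∈ s, (1 - q ^ (2 * a)) ≤ 1 := by
  have h : ∀ a : ℕ, 0 ≤ 1 - q ^ (2 * a) := fun a => SphereRep.one_sub_pow_nonneg hq0 hq1 _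
  refine ⟨Finset.prod_nonneg fun a _ => h a, Finset.prod_le_one (fun a _ => h a) fun a _ => ?_⟩
  linarith [pow_nonneg hq0.le (2 * a)]

theorem zetaCoeff_mem_unitInterval (hq0 : 0 < q) (hq1 : q < 1) (m : Fin n → ℕ) (i : Fin n) :
    0 ≤ zetaCoeff q p r m i ∧ zetaCoeff q p r m i ≤ 1 := by
  have h := prod_mem_unitInterval hq0 hq1
    (Finset.Ioc (kappa p r m i) (kappa p r m i + p i.castSucc))
  exact ⟨mul_nonneg (pow_nonneg hq0.le _) (Real.sqrt_nonneg _),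
    mul_le_one₀ (pow_le_one₀ hq0.le hq1.le) (Real.sqrt_nonneg _) (Real.sqrt_le_one.2 h.2)⟩

/-- A number in [0, 1] is at most its square root, so the root can be dropped; then ∏ (1 - t_s) ≥ 1
- ∑ t_s, where each of the N terms is at most q^a. -/
theorem one_sub_sqrt_prod_le (hq0 : 0 < q) (hq1 : q < 1) (a N : ℕ) :
    1 - √(∏ s ∈ Finset.Ioc a (a + N), (1 - q ^ (2 * s))) ≤ N * q ^ a := by
  obtain ⟨h0, h1⟩ := prod_mem_unitInterval hq0 hq1 (Finset.Ioc a (a + N))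
  have h2 : ∏ s ∈ Finset.Ioc a (a + N), (1 - q ^ (2 * s)) ≤
      √(∏ s ∈ Finset.Ioc a (a + N), (1 - q ^ (2 * s))) :=
    Real.le_sqrt_of_sq_le (by nlinarith)
  have h3 : 1 - ∑ s ∈ Finset.Ioc a (a + N), q ^ (2 * s) ≤
      ∏ s ∈ Finset.Ioc a (a + N), (1 - q ^ (2 * s)) := by
    induction Finset.Ioc a (a + N) using Finset.induction_on with
    | empty => simp
    | insert b s hb ih =>
      rw [Finset.sum_insert hb, Finset.prod_insert hb]
      have h5 := prod_mem_unitInterval hq0 hq1 s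
      have h6 : 0 ≤ q ^ (2 * b) := pow_nonneg hq0.le _
      nlinarith [mul_le_mul_of_nonneg_left h5.2 h6]
  have h4 : ∑ s ∈ Finset.Ioc a (a + N), q ^ (2 * s) ≤ N * q ^ a := by
    refine (Finset.sum_le_card_nsmul _ _ (q ^ a) fun s hs => ?_).trans (by simp)
    exact pow_le_pow_of_le_one hq0.le hq1.le (by have := (Finset.mem_Ioc.1 hs).1; omega)
  linarith

theorem norm_ket {N : ℕ} (m : Fin N → ℕ) : ‖ket m‖ = 1 := orthonormal_basisVec.1 m

theorem inner_ket {N : ℕ} (m m' : Fin N → ℕ) :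
    inner ℂ (ket m) (ket m') = if m = m' then (1 : ℂ) else 0 := inner_basisVec m m'

namespace IsBlockRep

variable {k : Fin (n + 1)} {π : sharpLens n q p →⋆ₙₐ[ℂ] (Hn n →L[ℂ] Hn n)}

theorem zeta_ket (h : IsBlockRep p r k π) {i : Fin n} (hi : i.castSucc < k) {m : Fin n → ℕ}
    (hm : InV k m) :
    π (lensZeta p i.castSucc) (ket m) = (zetaCoeff q p r m i : ℂ) • ket (m + eVec i k) :=
  h.zeta_lt i m hi hm

theorem star_zeta_ket (h : IsBlockRep p r k π) {i : Fin n} (hi : i.castSucc < k)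
    {m : Fin n → ℕ} (hm : InV k m) :
    star (π (lensZeta p i.castSucc)) (ket (m + eVec i k)) =
      (zetaCoeff q p r m i : ℂ) • ket m := by
  refine eq_of_inner_basisVec fun m' => ?_
  rw [star_eq_adjoint, adjoint_inner_right, basisVec_eq_ket, inner_smul_right, inner_ket]
  by_cases hm' : InV k m'
  · rw [h.zeta_ket hi hm', inner_smul_left, inner_ket, Complex.conj_ofReal]
    simp only [add_left_inj]
    split_ifs with he
    · rw [he]
    · simp
  · rw [h.zeta_off _ m' hm', if_neg (by rintro rfl; exact hm' hm)]
    simp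

theorem star_zeta_ket_eq_zero (h : IsBlockRep p r k π) {i : Fin n} (hi : i.castSucc < k)
    {m : Fin n → ℕ} (he : coord m i = coord m (i + 1)) :
    star (π (lensZeta p i.castSucc)) (ket m) = 0 := by
  have hk : (k : ℕ) ≤ n := Nat.lt_succ_iff.1 k.2
  have hi' : (i : ℕ) < k := hi
  refine eq_of_inner_basisVec fun m' => ?_
  rw [star_eq_adjoint, adjoint_inner_right, basisVec_eq_ket, inner_zero_right]
  by_cases hm' : InV k m'
  · rw [h.zeta_ket hi hm', inner_smul_left, inner_ket, if_neg, mul_zero]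
    rintro rfl
    rw [coord_add_eVec m' i hk, coord_add_eVec m' i hk, if_neg (by omega), if_pos (by omega)] at he
    have := hm'.coord_le_succ hi'
    omega
  · rw [h.zeta_off _ m' hm']
    simp

theorem star_zeta_ket_self (h : IsBlockRep p r k π) {m : Fin n → ℕ} (hm : InV k m) :
    star (π (lensZeta p k)) (ket m) = ((q ^ (p k * kappaSum p r m k) : ℝ) : ℂ) • ket m := by
  refine eq_of_inner_basisVec fun m' => ?_
  rw [star_eq_adjoint, adjoint_inner_right, basisVec_eq_ket, inner_smul_right, inner_ket]
  by_cases hm' : InV k m'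
  · rw [h.zeta_self m' hm', inner_smul_left, inner_ket, Complex.conj_ofReal]
    split_ifs with he
    · rw [he]
    · simp
  · rw [h.zeta_off _ m' hm', if_neg (by rintro rfl; exact hm' hm)]
    simp

theorem exists_one_ket (h : IsBlockRep p r k π) (m : Fin n → ℕ) :
    ∃ c : ℂ, π 1 (ket m) = c • ket m := by
  have hx : ∀ i, ∃ c : ℂ, π (lensX p i) (ket m) = c • ket m := by
    intro i
    by_cases hm : InV k m
    · rcases lt_trichotomy i k with hi | rfl | hi
      · obtain ⟨j, rfl⟩ := Fin.exists_castSucc_eq.2 (Fin.ne_last_of_lt hi)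
        exact ⟨_, h.x_lt j m hi hm⟩
      · exact ⟨_, h.x_self m hm⟩
      · exact ⟨0, by rw [h.x_gt i hi]; simp⟩
    · exact ⟨0, by rw [h.x_off i m hm]; simp⟩
  choose c hc using hx
  exact ⟨∑ i, c i, by rw [← sum_lensX, map_sum, sum_apply, Finset.sum_smul]; simp only [hc]⟩

/-- π(a) = π(a)π(1), and π(1) = ∑ π(x_i) already kills this vector. -/
theorem apply_ket_eq_zero (h : IsBlockRep p r k π) {m : Fin n → ℕ} (hm : ¬ InV k m)
    (a : sharpLens n q p) : π a (ket m) = 0 := by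
  have h1 : π 1 (ket m) = 0 := by
    rw [← sum_lensX, map_sum, sum_apply]
    exact Finset.sum_eq_zero fun i _ => h.x_off i m hm
  rw [← mul_one a, map_mul, clm_mul_apply, h1, map_zero]

/-- π(1) and π'(1) are diagonal in the canonical basis and have disjoint supports. -/
theorem mul_eq_zero (h : IsBlockRep p r k π) {l : Fin (n + 1)}
    {π' : sharpLens n q p →⋆ₙₐ[ℂ] (Hn n →L[ℂ] Hn n)} (h' : IsBlockRep p r l π')
    (hkl : ∀ m, InV l m → ¬ InV k m) (a b : sharpLens n q p) : π a * π' b = 0 := by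
  have h1 : π 1 * π' 1 = 0 := by
    refine SphereRep.clm_ext_ket fun m => ?_
    rw [clm_mul_apply, zero_apply]
    by_cases hm : InV l m
    · obtain ⟨c, hc⟩ := h'.exists_one_ket m
      rw [hc, map_smul, h.apply_ket_eq_zero (hkl m hm), smul_zero]
    · rw [h'.apply_ket_eq_zero hm, map_zero]
  rw [← mul_one a, ← one_mul b, map_mul, map_mul, mul_assoc, ← mul_assoc (π 1), h1, zero_mul,
    mul_zero]

end IsBlockRep

/-! ### The two representations at a peak, compared on generators -/

variable {j : Fin n} {π₁ π₂ : sharpLens n q p →⋆ₙₐ[ℂ] (Hn n →L[ℂ] Hn n)}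
  (h₁ : IsBlockRep p r j.castSucc π₁) (h₂ : IsBlockRep p r j.succ π₂)
  (hq0 : 0 < q) (hq1 : q < 1) (hp : ∀ i, 0 < p i)

include hq0 hq1 hp in
theorem pow_kappaSum_le (m : Fin n → ℕ) {N : ℕ} (hN : 0 < N) :
    q ^ (N * kappaSum p r m (j + 1)) ≤ q ^ coord m (j + 1) :=
  pow_le_pow_of_le_one hq0.le hq1.le
    ((coord_le_kappaSum hp m j.2).trans (Nat.le_mul_of_pos_left _ hN))

-- The two representations differ only at the indices i = j and i = j + 1. At both the discrepancy
-- has absolute value q^{2S_{j+1}}: in the first case q^{2S_j} - q^{2S_j}(1 - q^{2κ_j}), in the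
-- second the eigenvalue of x_{j+1} in π_{j+1}.
include h₁ h₂ hq0 hq1 hp in
theorem norm_x_sub_le {m : Fin n → ℕ} (hm₁ : InV j.castSucc m) (hm₂ : InV j.succ m)
    (i : Fin (n + 1)) :
    ‖π₁ (lensX p i) (ket m) - π₂ (lensX p i) (ket m)‖ ≤ q ^ coord m (j + 1) := by
  have hpos : 0 ≤ q ^ coord m (j + 1) := pow_nonneg hq0.le _
  have hle := pow_kappaSum_le (r := r) hq0 hq1 hp (j := j) m two_pos
  have hjs : j.castSucc < j.succ := Fin.castSucc_lt_succ
  rcases lt_trichotomy i j.castSucc with hi | rfl | hi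
  · obtain ⟨i, rfl⟩ := Fin.exists_castSucc_eq.2 (Fin.ne_last_of_lt hi)
    rw [h₁.x_lt i m hi hm₁, h₂.x_lt i m (hi.trans hjs) hm₂, sub_self, norm_zero]
    exact hpos
  · rw [h₁.x_self m hm₁, h₂.x_lt j m hjs hm₂, ← sub_smul, ← Complex.ofReal_sub, norm_smul, norm_ket,
      mul_one, Complex.norm_real, Fin.val_castSucc]
    have : q ^ (2 * kappaSum p r m j) -
        q ^ (2 * kappaSum p r m j) * (1 - q ^ (2 * kappa p r m j)) =
        q ^ (2 * kappaSum p r m (j + 1)) := by rw [kappaSum_succ]; ring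
    rw [this, Real.norm_of_nonneg (pow_nonneg hq0.le _)]
    exact hle
  · rw [h₁.x_gt i hi]
    rcases (Fin.castSucc_lt_iff_succ_le.1 hi).eq_or_lt with rfl | hi'
    · rw [h₂.x_self m hm₂, zero_apply, zero_sub, norm_neg, norm_smul, norm_ket, mul_one,
        Complex.norm_real, Real.norm_of_nonneg (pow_nonneg hq0.le _)]
      exact hle
    · rw [h₂.x_gt i hi', zero_apply, sub_self, norm_zero]
      exact hpos

-- For l < j the two sides agree and for l > j + 1 both vanish; only l = j and l = j + 1 need
-- estimates. The case i > l will follow by taking adjoints.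
include h₁ h₂ hq0 hq1 hp in
theorem norm_zeta_sub_le (hr : ∀ j : Fin n, r j < p j.castSucc) {i l : Fin (n + 1)} (hil : i < l) :
    ∃ C : ℝ, 0 ≤ C ∧ ∀ m : Fin n → ℕ, InV j.castSucc m → InV j.succ m →
      ‖π₁ (lensZeta p i * star (lensZeta p l)) (ket m) -
        π₂ (lensZeta p i * star (lensZeta p l)) (ket m)‖ ≤ C * q ^ coord m (j + 1) := by
  have hjs : j.castSucc < j.succ := Fin.castSucc_lt_succ
  have hjn : (j.castSucc : ℕ) ≤ n := j.2.le
  have hjn' : (j.succ : ℕ) ≤ n := j.2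
  obtain ⟨i, rfl⟩ := Fin.exists_castSucc_eq.2 (Fin.ne_last_of_lt hil)
  have hil' : (i : ℕ) < l := hil
  simp only [map_mul, map_star, clm_mul_apply]
  rcases lt_trichotomy l j.castSucc with hl | rfl | hl
  · refine ⟨0, le_rfl, fun m hm₁ hm₂ => ?_⟩
    obtain ⟨l, rfl⟩ := Fin.exists_castSucc_eq.2 (Fin.ne_last_of_lt hl)
    have hl' : (l : ℕ) < j := hl
    simp only [Fin.val_castSucc] at hil'
    have hi : i.castSucc < j.castSucc := hil.trans hl
    rcases (hm₁.coord_le_succ hl).eq_or_lt with he | hlt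
    · rw [h₁.star_zeta_ket_eq_zero hl he, h₂.star_zeta_ket_eq_zero (hl.trans hjs) he]
      simp
    -- The intermediate vectors after ζ_l* differ in the two representations, but only in the
    -- coordinate m_{j+1}, which the coefficients do not see; ζ_i then restores a common vector.
    · obtain ⟨m', hm', e'⟩ := hm₁.exists_eq_add_eVec hl hlt
      obtain ⟨m'', hm'', e''⟩ := hm₂.exists_eq_add_eVec (hl.trans hjs) hlt
      have hc' : ∀ a, coord m a = coord m' a + if (l : ℕ) < a ∧ a ≤ j then 1 else 0 := by
        intro a; rw [e', coord_add_eVec m' _ hjn]; rfl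
      have hc'' : ∀ a, coord m a = coord m'' a + if (l : ℕ) < a ∧ a ≤ j + 1 then 1 else 0 := by
        intro a; rw [e'', coord_add_eVec m'' _ hjn']; rfl
      have hc : ∀ a ≤ (j : ℕ), coord m' a = coord m'' a := by
        intro a ha
        have h1 := hc' a
        have h2 := hc'' a
        split_ifs at h1 h2 <;> omega
      have hv : m' + eVec i j.castSucc = m'' + eVec i j.succ := by
        refine coord_injective fun a _ => ?_
        rw [coord_add_eVec m' _ hjn, coord_add_eVec m'' _ hjn']
        have h1 := hc' a
        have h2 := hc'' a
        simp only [Fin.val_castSucc, Fin.val_succ]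
        split_ifs at h1 h2 ⊢ <;> omega
      have s₁ := h₁.star_zeta_ket hl hm'
      have s₂ := h₂.star_zeta_ket (hl.trans hjs) hm''
      simp only [Fin.val_castSucc] at e' e''
      rw [Fin.val_castSucc, ← e'] at s₁
      rw [← e''] at s₂
      rw [s₁, s₂, map_smul, map_smul, h₁.zeta_ket hi hm', h₂.zeta_ket (hi.trans hjs) hm'', hv,
        zetaCoeff_congr (m := m') (m' := m'') fun a ha => hc a (by omega),
        zetaCoeff_congr (m := m') (m' := m'') fun a ha => hc a (by omega)]
      simp
  -- The two entries of the maximum belong to the cases m_j = m_{j+1} and m_j < m_{j+1} below; both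
  -- lose the same factor q^{-p_j}.
  · refine ⟨max ‖π₁ (lensZeta p i.castSucc)‖ (p j.castSucc) * (q ^ p j.castSucc)⁻¹,
      by positivity, fun m hm₁ hm₂ => ?_⟩
    have hqp : 0 < q ^ p j.castSucc := pow_pos hq0 _
    have hM : q ^ kappaSum p r m (j + 1) ≤ q ^ coord m (j + 1) :=
      pow_le_pow_of_le_one hq0.le hq1.le (coord_le_kappaSum hp m j.2)
    have hS : q ^ (p j.castSucc * kappaSum p r m j) ≤ q ^ kappaSum p r m j :=
      pow_le_pow_of_le_one hq0.le hq1.le (Nat.le_mul_of_pos_left _ (hp _))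
    have hi₁ : i.castSucc < j.castSucc := hil
    simp only [Fin.val_castSucc] at hil'
    rw [h₁.star_zeta_ket_self hm₁, map_smul, Fin.val_castSucc]
    rcases (hm₂.coord_le_succ hjs).eq_or_lt with he | hlt
    · rw [h₂.star_zeta_ket_eq_zero hjs he, map_zero, sub_zero, norm_smul, Complex.norm_real,
        Real.norm_of_nonneg (pow_nonneg hq0.le _)]
      -- Here π_{j+1} contributes nothing. Since κ_j = r_j < p_j, the surviving coefficient q^{p_j
      -- S_j} is at most q^{-p_j} q^{S_{j+1}}.
      have hκ : kappaSum p r m (j + 1) ≤ kappaSum p r m j + p j.castSucc := by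
        simp only [Fin.val_castSucc] at he
        rw [kappaSum_succ, kappa, he, Nat.sub_self, mul_zero, zero_add]
        have := hr j
        omega
      have h3 : q ^ kappaSum p r m j * q ^ p j.castSucc ≤ q ^ coord m (j + 1) := by
        rw [← pow_add]
        exact (pow_le_pow_of_le_one hq0.le hq1.le hκ).trans hM
      have h4 : ‖π₁ (lensZeta p i.castSucc) (ket m)‖ ≤
          max ‖π₁ (lensZeta p i.castSucc)‖ (p j.castSucc) := by
        refine le_trans ?_ (le_max_left _ _)
        simpa [norm_ket] using (π₁ (lensZeta p i.castSucc)).le_opNorm (ket m)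
      rw [mul_assoc, mul_comm]
      refine mul_le_mul h4 ?_ (pow_nonneg hq0.le _) ((norm_nonneg _).trans h4)
      refine hS.trans ?_
      rw [le_inv_mul_iff₀ hqp, mul_comm]
      exact h3
    · obtain ⟨m', hm', e'⟩ := hm₂.exists_eq_add_eVec hjs hlt
      simp only [Fin.val_castSucc] at e'
      have hc' : ∀ a, coord m a = coord m' a + if (j : ℕ) < a ∧ a ≤ j + 1 then 1 else 0 := by
        intro a; rw [e', coord_add_eVec m' _ hjn']; rfl
      have hc : ∀ a ≤ (j : ℕ), coord m' a = coord m a := by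
        intro a ha
        have h1 := hc' a
        split_ifs at h1 <;> omega
      -- Both products reach the same basis vector, as e_{i,j} + e_{j,j+1} = e_{i,j+1}. The
      -- coefficients therefore subtract, leaving the small factor 1 - √∏.
      have hv : m' + eVec i j.succ = m + eVec i j.castSucc := by
        refine coord_injective fun a _ => ?_
        rw [coord_add_eVec m _ hjn, coord_add_eVec m' _ hjn']
        have h1 := hc' a
        simp only [Fin.val_castSucc, Fin.val_succ]
        split_ifs at h1 ⊢ <;> omega
      have s₂ := h₂.star_zeta_ket hjs hm'
      rw [← e'] at s₂
      have hκ : kappa p r m j = kappa p r m' j + p j.castSucc := by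
        have h1 := hc' j
        have h2 := hc' (j + 1)
        rw [if_neg (by omega)] at h1
        rw [if_pos (by omega)] at h2
        have h3 := hm'.coord_le_succ hjs
        simp only [Fin.val_castSucc] at h3
        have h4 : coord m (j + 1) - coord m j = coord m' (j + 1) - coord m' j + 1 := by omega
        rw [kappa, kappa, h4]; ring
      have hz : zetaCoeff q p r m' j = q ^ (p j.castSucc * kappaSum p r m' j) *
          √(∏ s ∈ Finset.Ioc (kappa p r m' j) (kappa p r m' j + p j.castSucc),
            (1 - q ^ (2 * s))) := rfl
      rw [s₂, map_smul, h₁.zeta_ket hi₁ hm₁, h₂.zeta_ket (hi₁.trans hjs) hm', hv,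
        zetaCoeff_congr (m := m') (m' := m) (i := i) fun a ha => hc a (by omega), smul_smul,
        smul_smul, ← sub_smul, norm_smul, norm_ket, mul_one, ← Complex.ofReal_mul,
        ← Complex.ofReal_mul, ← Complex.ofReal_sub, Complex.norm_real, ← sub_mul,
        hz, kappaSum_congr (m := m') (m' := m) hc]
      obtain ⟨z0, z1⟩ := zetaCoeff_mem_unitInterval (p := p) (r := r) hq0 hq1 m i
      have h5 := one_sub_sqrt_prod_le hq0 hq1 (kappa p r m' j) (p j.castSucc)
      have h6 : 0 ≤ 1 - √(∏ s ∈ Finset.Ioc (kappa p r m' j) (kappa p r m' j + p j.castSucc),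
          (1 - q ^ (2 * s))) :=
        sub_nonneg.2 (Real.sqrt_le_one.2 (prod_mem_unitInterval hq0 hq1 _).2)
      set R := √(∏ s ∈ Finset.Ioc (kappa p r m' j) (kappa p r m' j + p j.castSucc),
          (1 - q ^ (2 * s)))
      rw [← mul_one_sub, Real.norm_of_nonneg (mul_nonneg (mul_nonneg (pow_nonneg hq0.le _) h6) z0)]
      calc q ^ (p j.castSucc * kappaSum p r m j) * (1 - R) * zetaCoeff q p r m i
          ≤ q ^ kappaSum p r m j * (p j.castSucc * q ^ kappa p r m' j) * 1 := by gcongr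
        _ = p j.castSucc * (q ^ p j.castSucc)⁻¹ * q ^ kappaSum p r m (j + 1) := by
            rw [kappaSum_succ, hκ, pow_add, pow_add]; field_simp
        _ ≤ _ := by gcongr; exact le_max_right _ _
  · rcases (Fin.castSucc_lt_iff_succ_le.1 hl).eq_or_lt with rfl | hl'
    -- For l = j + 1 the first term vanishes and ζ_l* is the diagonal factor q^{p_l S_l}, small by
    -- itself.
    · refine ⟨‖π₂ (lensZeta p i.castSucc)‖, norm_nonneg _, fun m hm₁ hm₂ => ?_⟩
      rw [h₁.zeta_gt _ hl, h₂.star_zeta_ket_self hm₂]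
      simp only [star_zero, zero_apply, map_zero, zero_sub, norm_neg, map_smul]
      rw [norm_smul, Complex.norm_real, Real.norm_of_nonneg (pow_nonneg hq0.le _), mul_comm]
      refine mul_le_mul ?_ (pow_kappaSum_le hq0 hq1 hp m (hp _)) (pow_nonneg hq0.le _)
        (norm_nonneg _)
      simpa [norm_ket] using (π₂ (lensZeta p i.castSucc)).le_opNorm (ket m)
    · refine ⟨0, le_rfl, fun m hm₁ hm₂ => ?_⟩
      rw [h₁.zeta_gt _ hl, h₂.zeta_gt _ hl']
      simp

end Compare
end QWP

namespace QWP

/-! ### The difference of the even and the odd representations -/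

section Difference

open ContinuousLinearMap

variable {n : ℕ} {q : ℝ} {p : Fin (n + 1) → ℕ} {r : Fin n → ℕ}
  {π : Fin (n + 1) → (sharpLens n q p →⋆ₙₐ[ℂ] (Hn n →L[ℂ] Hn n))}

/-- The sum of mutually orthogonal representations. -/
noncomputable def sumRep (s : Finset (Fin (n + 1)))
    (hs : ∀ k ∈ s, ∀ l ∈ s, k ≠ l → ∀ a b, π k a * π l b = 0) :
    sharpLens n q p →⋆ₙₐ[ℂ] (Hn n →L[ℂ] Hn n) where
  toFun a := ∑ k ∈ s, π k a
  map_smul' c a := by simp [Finset.smul_sum]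
  map_zero' := by simp
  map_add' a b := by simp [Finset.sum_add_distrib]
  map_mul' a b := by
    rw [Finset.sum_mul_sum]
    refine Finset.sum_congr rfl fun k hk => ?_
    rw [Finset.sum_eq_single_of_mem k hk fun l hl hlk => hs k hk l hl hlk.symm a b, map_mul]
  map_star' a := by simp only [map_star, star_sum]

variable (hn : 1 ≤ n) (hπ : ∀ k, IsBlockRep p r k (π k))

-- A basis vector common to V_k and V_l forces k and l to be equal or consecutive, and consecutive
-- indices have opposite parity.
include hn hπ in
theorem mul_eq_zero_of_parity {k l : Fin (n + 1)} (hkl : k ≠ l)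
    (h : (Even (k : ℕ) ↔ Even (l : ℕ))) (a b : sharpLens n q p) : π k a * π l b = 0 := by
  refine (hπ k).mul_eq_zero (hπ l) (fun m hl hk => ?_) a b
  obtain ⟨j, h1, h2⟩ := hl.exists_peak hn
  rcases h1.eq_or_eq h2 hl with rfl | rfl <;> rcases h1.eq_or_eq h2 hk with rfl | rfl
  · exact hkl rfl
  · simp only [Fin.val_succ, Fin.val_castSucc, Nat.even_add_one] at h
    exact not_iff_self h
  · simp only [Fin.val_succ, Fin.val_castSucc, Nat.even_add_one] at h
    exact not_iff_self h.symm
  · exact hkl rfl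

include hn hπ in
theorem exists_piPlus : ∃ ρ : sharpLens n q p →⋆ₙₐ[ℂ] (Hn n →L[ℂ] Hn n),
    ∀ a, ρ a = piPlus π a :=
  ⟨sumRep (π := π) (Finset.univ.filter fun k : Fin (n + 1) => Even (k : ℕ))
    fun _ hk _ hl hkl => mul_eq_zero_of_parity hn hπ hkl
      (iff_of_true (Finset.mem_filter.1 hk).2 (Finset.mem_filter.1 hl).2), fun _ => rfl⟩

include hn hπ in
theorem exists_piMinus : ∃ ρ : sharpLens n q p →⋆ₙₐ[ℂ] (Hn n →L[ℂ] Hn n),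
    ∀ a, ρ a = piMinus π a :=
  ⟨sumRep (π := π) (Finset.univ.filter fun k : Fin (n + 1) => Odd (k : ℕ))
    fun _ hk _ hl hkl => mul_eq_zero_of_parity hn hπ hkl
      (iff_of_false (Nat.not_even_iff_odd.2 (Finset.mem_filter.1 hk).2)
        (Nat.not_even_iff_odd.2 (Finset.mem_filter.1 hl).2)), fun _ => rfl⟩

theorem piPlus_sub_piMinus (a : sharpLens n q p) :
    piPlus π a - piMinus π a = ∑ k : Fin (n + 1), (-1 : ℂ) ^ (k : ℕ) • π k a := by
  rw [piPlus, piMinus, Finset.sum_filter, Finset.sum_filter, ← Finset.sum_sub_distrib]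
  refine Finset.sum_congr rfl fun k _ => ?_
  rcases Nat.even_or_odd (k : ℕ) with h | h
  · simp [h, Nat.not_odd_iff_even.2 h]
  · simp [h, Nat.not_even_iff_odd.2 h]

include hπ in
theorem norm_piPlus_sub_piMinus_ket {j : Fin n} {m : Fin n → ℕ} (h1 : InV j.castSucc m)
    (h2 : InV j.succ m) (a : sharpLens n q p) :
    ‖(piPlus π a - piMinus π a) (ket m)‖ =
      ‖π j.castSucc a (ket m) - π j.succ a (ket m)‖ := by
  rw [piPlus_sub_piMinus, sum_apply, Finset.sum_eq_add (a := j.castSucc) (b := j.succ)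
    Fin.castSucc_lt_succ.ne]
  · rw [smul_apply, smul_apply, Fin.val_castSucc, Fin.val_succ, pow_succ, mul_smul, ← smul_add,
      norm_smul]
    simp [sub_eq_add_neg]
  · rintro k - ⟨hk, hk'⟩
    rw [smul_apply, (hπ k).apply_ket_eq_zero, smul_zero]
    exact fun hkm => (h1.eq_or_eq h2 hkm).elim hk hk'
  · simp
  · simp

include hn hπ in
theorem piPlus_sub_piMinus_ket_eq_zero {m : Fin n → ℕ}
    (h : ¬ ∃ j : Fin n, InV j.castSucc m ∧ InV j.succ m) (a : sharpLens n q p) :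
    (piPlus π a - piMinus π a) (ket m) = 0 := by
  rw [piPlus_sub_piMinus, sum_apply]
  refine Finset.sum_eq_zero fun k _ => ?_
  rw [smul_apply, (hπ k).apply_ket_eq_zero (fun hk => h (hk.exists_peak hn)), smul_zero]

/-- On a box the sum factors into a product of N truncated geometric series, and every finite set of
indices lies in a box. -/
theorem summable_pow_sum (N : ℕ) {s : ℝ} (hs0 : 0 ≤ s) (hs1 : s < 1) :
    Summable fun m : Fin N → ℕ => s ^ ∑ l, m l := by
  have hg := summable_geometric_of_lt_one hs0 hs1
  refine summable_of_sum_le (c := (∑' a : ℕ, s ^ a) ^ N) (fun m => pow_nonneg hs0 _) fun F => ?_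
  obtain ⟨M, hM⟩ : ∃ M, ∀ m ∈ F, ∀ l, m l < M := by
    refine ⟨∑ m ∈ F, ∑ l, m l + 1, fun m hm l => Nat.lt_succ_iff.2 ?_⟩
    exact (Finset.single_le_sum (f := m) (fun _ _ => Nat.zero_le _) (Finset.mem_univ l)).trans
      (Finset.single_le_sum (f := fun m : Fin N → ℕ => ∑ l, m l) (fun _ _ => Nat.zero_le _) hm)
  calc ∑ m ∈ F, s ^ ∑ l, m l
      ≤ ∑ m ∈ Fintype.piFinset fun _ : Fin N => Finset.range M, s ^ ∑ l, m l :=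
        Finset.sum_le_sum_of_subset_of_nonneg
          (fun m hm => Fintype.mem_piFinset.2 fun l => Finset.mem_range.2 (hM m hm l))
          fun _ _ _ => pow_nonneg hs0 _
    _ = ∏ _l : Fin N, ∑ a ∈ Finset.range M, s ^ a := by
        rw [Finset.prod_univ_sum]
        simp only [Finset.prod_pow_eq_pow_sum]
    _ ≤ _ := by
        rw [Finset.prod_const, Finset.card_univ, Fintype.card_fin]
        gcongr
        exact hg.sum_le_tsum _ fun _ _ => pow_nonneg hs0 _

variable (hq0 : 0 < q) (hq1 : q < 1) (hp : ∀ i, 0 < p i)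

include hn hπ hq0 hq1 in
theorem isNuclear_of_norm_le (a : sharpLens n q p) (C : Fin n → ℝ)
    (h : ∀ (j : Fin n) (m : Fin n → ℕ), InV j.castSucc m → InV j.succ m →
      ‖π j.castSucc a (ket m) - π j.succ a (ket m)‖ ≤ C j * q ^ coord m (j + 1)) :
    IsNuclear (piPlus π a - piMinus π a) := by
  -- The exponent 1/n is chosen so that q^{peak} = s^{n·peak} ≤ s^{m_1+...+m_n}, because each of the
  -- n coordinates is at most the peak.
  set s : ℝ := q ^ ((n : ℝ)⁻¹) with hs
  have hn0 : n ≠ 0 := by omega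
  have hs0 : 0 < s := Real.rpow_pos_of_pos hq0 _
  have hs1 : s < 1 := Real.rpow_lt_one hq0.le hq1 (by positivity)
  have hsn : s ^ n = q := Real.rpow_inv_natCast_pow hq0.le hn0
  refine IsNuclear.of_summable_norm (basisEllTwo (Fin n → ℕ)) ?_
  refine Summable.of_nonneg_of_le (fun _ => norm_nonneg _) (fun m => ?_)
    ((summable_pow_sum n hs0.le hs1).mul_left (∑ j, |C j|))
  rw [basisEllTwo_apply, basisVec_eq_ket]
  by_cases hm : ∃ j : Fin n, InV j.castSucc m ∧ InV j.succ m
  · obtain ⟨j, h1, h2⟩ := hm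
    rw [norm_piPlus_sub_piMinus_ket hπ h1 h2]
    refine (h j m h1 h2).trans ?_
    refine mul_le_mul ((le_abs_self _).trans (Finset.single_le_sum (f := fun j => |C j|)
      (fun _ _ => abs_nonneg _) (Finset.mem_univ j))) ?_ (pow_nonneg hq0.le _)
      (Finset.sum_nonneg fun _ _ => abs_nonneg _)
    rw [← hsn, ← pow_mul]
    refine pow_le_pow_of_le_one hs0.le hs1.le ?_
    calc ∑ l, m l ≤ ∑ _l : Fin n, coord m (j + 1) :=
          Finset.sum_le_sum fun l _ => h1.coord_le_peak h2 l
      _ = n * coord m (j + 1) := by simp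
  · rw [piPlus_sub_piMinus_ket_eq_zero hn hπ hm, norm_zero]
    exact mul_nonneg (Finset.sum_nonneg fun _ _ => abs_nonneg _) (pow_nonneg hs0.le _)

-- The elements with nuclear difference form a subalgebra containing the generators. The unit needs
-- separate treatment, the representations being non-unital; it is the sum of the x_i.
include hn hπ hq0 hq1 hp in
theorem isNuclear_piDiff (hcop : ∀ i j, i ≠ j → Nat.Coprime (p i) (p j))
    (hr : ∀ j : Fin n, r j < p j.castSucc) (a : weightedProj n q (sharp p)) :
    IsNuclear (piDiff π a) := by
  obtain ⟨ρ₁, hρ₁⟩ := exists_piPlus hn hπ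
  obtain ⟨ρ₂, hρ₂⟩ := exists_piMinus hn hπ
  have hD : ∀ b, piDiff π b = ρ₁ (toLens b) - ρ₂ (toLens b) := fun b => by
    rw [hρ₁, hρ₂]; rfl
  have hadd : ∀ b c : weightedProj n q (sharp p), toLens (b + c) = toLens b + toLens c :=
    fun b c => map_add (StarSubalgebra.inclusion _) b c
  have hmul : ∀ b c : weightedProj n q (sharp p), toLens (b * c) = toLens b * toLens c :=
    fun b c => map_mul (StarSubalgebra.inclusion _) b c
  have hX : ∀ i, IsNuclear (piDiff π (projX p i)) := fun i =>
    isNuclear_of_norm_le hn hπ hq0 hq1 _ (fun _ => 1) fun j m h1 h2 => by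
      rw [one_mul, toLens_projX]
      exact norm_x_sub_le (hπ _) (hπ _) hq0 hq1 hp h1 h2 i
  have hZ : ∀ i l, i < l → IsNuclear (piDiff π (projZeta p i l)) := by
    intro i l hil
    choose C _ hC using fun j : Fin n =>
      norm_zeta_sub_le (hπ j.castSucc) (hπ j.succ) hq0 hq1 hp hr hil
    exact isNuclear_of_norm_le hn hπ hq0 hq1 _ C hC
  have ha : a ∈ Algebra.adjoin ℂ (Set.range (projX p) ∪
      {a | ∃ i j, i ≠ j ∧ a = projZeta p i j} : Set (weightedProj n q (sharp p))) := by
    rw [adjoin_weightedProj hq0.ne' hp hcop]; trivial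
  have hsum : IsNuclear (piDiff π 1) := by
    have h1 : toLens (1 : weightedProj n q (sharp p)) = ∑ i, lensX p i := sum_lensX.symm
    have h2 : piDiff π 1 = ∑ i, piDiff π (projX p i) := by
      simp only [hD]
      rw [h1, map_sum, map_sum, ← Finset.sum_sub_distrib]
      rfl
    rw [h2]
    exact Finset.sum_induction _ IsNuclear (fun _ _ => IsNuclear.add) IsNuclear.zero
      fun i _ => hX i
  refine Algebra.adjoin_induction (p := fun b _ => IsNuclear (piDiff π b)) ?_ ?_ ?_ ?_ ha
  · rintro _ (⟨i, rfl⟩ | ⟨i, l, hil, rfl⟩)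
    · exact hX i
    · rcases lt_or_gt_of_ne hil with h | h
      · exact hZ i l h
      -- Since ζ_i ζ_l* is the adjoint of ζ_l ζ_i*, the estimate for i < l suffices.
      · have h1 : piDiff π (projZeta p i l) = star (piDiff π (projZeta p l i)) := by
          rw [hD, hD, star_sub, ← map_star, ← map_star, toLens_projZeta, toLens_projZeta, star_mul,
            star_star]
        rw [h1, star_eq_adjoint]
        exact (hZ l i h).adjoint
  · intro c
    have h1 : toLens (algebraMap ℂ (weightedProj n q (sharp p)) c) = c • toLens 1 := by
      rw [Algebra.algebraMap_eq_smul_one]; rfl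
    have h2 : piDiff π (algebraMap ℂ (weightedProj n q (sharp p)) c) = c • piDiff π 1 := by
      rw [hD, hD, h1, map_smul, map_smul, smul_sub]
    rw [h2]
    exact hsum.smul c
  · intro b c _ _ hb hc
    have : piDiff π (b + c) = piDiff π b + piDiff π c := by
      rw [hD, hD, hD, hadd, map_add, map_add]; abel
    rw [this]
    exact hb.add hc
  · intro b c _ _ hb hc
    have : piDiff π (b * c) = ρ₁ (toLens b) ∘L piDiff π c + piDiff π b ∘L ρ₂ (toLens c) := by
      rw [hD, hD, hD, hmul, map_mul, map_mul]
      change _ = ρ₁ (toLens b) * (ρ₁ (toLens c) - ρ₂ (toLens c)) +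
        (ρ₁ (toLens b) - ρ₂ (toLens b)) * ρ₂ (toLens c)
      rw [mul_sub, sub_mul]; abel
    rw [this]
    exact (hc.comp_left _).add (hb.comp_right _)

/-- The trace formula holds in every basis, in particular in the canonical one, where unconditional
convergence of a complex series is absolute convergence. -/
theorem IsNuclear.hasTrace_tsum {N : ℕ} {T : Hn N →L[ℂ] Hn N} (hT : IsNuclear T) :
    Summable (fun m : Fin N → ℕ => ‖inner ℂ (ket m) (T (ket m))‖) ∧
      HasTrace T (∑' m : Fin N → ℕ, inner ℂ (ket m) (T (ket m))) := by
  obtain ⟨τ, hτ⟩ := hT.exists_hasTrace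
  have h := hτ _ (basisEllTwo (Fin N → ℕ))
  simp only [basisEllTwo_apply, basisVec_eq_ket] at h
  exact ⟨h.summable.norm, h.tsum_eq.symm ▸ hτ⟩

end Difference

/-! ### The Fredholm module -/

section Fredholm

open ContinuousLinearMap

universe u

variable {H : Type u} [NormedAddCommGroup H] [InnerProductSpace ℂ H] [CompleteSpace H]

theorem directSum_apply (S T : H →L[ℂ] H) (x : WithLp 2 (H × H)) :
    directSum S T x = WithLp.toLp 2 (S x.fst, T x.snd) := rfl

theorem flipOp_apply (x : WithLp 2 (H × H)) :
    flipOp H x = WithLp.toLp 2 (x.snd, x.fst) := rfl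

theorem clm_ext_prod {S T : WithLp 2 (H × H) →L[ℂ] WithLp 2 (H × H)}
    (h₁ : ∀ x, (S x).fst = (T x).fst) (h₂ : ∀ x, (S x).snd = (T x).snd) : S = T :=
  ContinuousLinearMap.ext fun x => WithLp.ofLp_injective 2 (Prod.ext (h₁ x) (h₂ x))

theorem star_directSum (S T : H →L[ℂ] H) :
    star (directSum S T) = directSum (star S) (star T) := by
  rw [star_eq_adjoint]
  refine ((eq_adjoint_iff _ _).2 fun x y => ?_).symm
  simp [directSum_apply, WithLp.prod_inner_apply, star_eq_adjoint, adjoint_inner_left]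

theorem isSelfAdjoint_flipOp : IsSelfAdjoint (flipOp H) := by
  rw [IsSelfAdjoint, star_eq_adjoint]
  refine ((eq_adjoint_iff _ _).2 fun x y => ?_).symm
  simp [flipOp_apply, WithLp.prod_inner_apply, add_comm]

/-- The direct sum of two representations. -/
noncomputable def directSumRep {A : Type*} [Ring A] [StarRing A] [Algebra ℂ A]
    (ρ₁ ρ₂ : A →⋆ₙₐ[ℂ] (H →L[ℂ] H)) :
    A →⋆ₙₐ[ℂ] (WithLp 2 (H × H) →L[ℂ] WithLp 2 (H × H)) where
  toFun a := directSum (ρ₁ a) (ρ₂ a)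
  map_smul' c a := by apply clm_ext_prod <;> intro x <;> simp [directSum_apply]
  map_zero' := by apply clm_ext_prod <;> intro x <;> simp [directSum_apply]
  map_add' a b := by apply clm_ext_prod <;> intro x <;> simp [directSum_apply]
  map_mul' a b := by apply clm_ext_prod <;> intro x <;> simp [directSum_apply]
  map_star' a := by rw [star_directSum, map_star, map_star]

/-- The commutator sends v ⊕ w to -(S - T)w ⊕ (S - T)v, so the ideal property reduces the claim to S
- T. -/
theorem isNuclear_commutator {S T : H →L[ℂ] H} (h : IsNuclear (S - T)) :
    IsNuclear (flipOp H * directSum S T - directSum S T * flipOp H) := by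
  let e : WithLp 2 (H × H) ≃L[ℂ] H × H := WithLp.prodContinuousLinearEquiv 2 ℂ H H
  let i₁ : H →L[ℂ] WithLp 2 (H × H) := e.symm ∘L ContinuousLinearMap.inl ℂ H H
  let i₂ : H →L[ℂ] WithLp 2 (H × H) := e.symm ∘L ContinuousLinearMap.inr ℂ H H
  let p₁ : WithLp 2 (H × H) →L[ℂ] H := ContinuousLinearMap.fst ℂ H H ∘L
    (e : WithLp 2 (H × H) →L[ℂ] H × H)
  let p₂ : WithLp 2 (H × H) →L[ℂ] H := ContinuousLinearMap.snd ℂ H H ∘L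
    (e : WithLp 2 (H × H) →L[ℂ] H × H)
  have : flipOp H * directSum S T - directSum S T * flipOp H =
      i₂ ∘L ((S - T) ∘L p₁) + (-(i₁ ∘L ((S - T) ∘L p₂))) := by
    apply clm_ext_prod <;> intro x <;> simp [directSum_apply, flipOp_apply, i₁, i₂, p₁, p₂, e]
  rw [this]
  exact ((h.comp_right p₁).comp_left i₂).add ((h.comp_right p₂).comp_left i₁).neg

theorem isOneSummableEvenFredholmModule_directSum {A : Type*} [Ring A] [StarRing A] [Algebra ℂ A]
    (ρ₁ ρ₂ : A →⋆ₙₐ[ℂ] (H →L[ℂ] H)) (h : ∀ a, IsNuclear (ρ₁ a - ρ₂ a)) :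
    IsOneSummableEvenFredholmModule (fun a => directSum (ρ₁ a) (ρ₂ a)) (flipOp H)
      (grading H) where
  representation := ⟨directSumRep ρ₁ ρ₂, fun _ => rfl⟩
  F_selfAdjoint := isSelfAdjoint_flipOp
  F_sq := by apply clm_ext_prod <;> intro x <;> simp [flipOp_apply]
  grading_selfAdjoint := by rw [IsSelfAdjoint, grading, star_directSum]; simp
  grading_sq := by apply clm_ext_prod <;> intro x <;> simp [grading, directSum_apply]
  F_odd := by apply clm_ext_prod <;> intro x <;> simp [grading, directSum_apply, flipOp_apply]
  even a := by apply clm_ext_prod <;> intro x <;> simp [grading, directSum_apply]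
  compact a := (isNuclear_commutator (h a)).isCompactOperator
  traceClass a := (isNuclear_commutator (h a)).isTraceClass

end Fredholm

end QWP
-- The main theorem
theorem mainTheorem8 (n : ℕ) (hn : 1 ≤ n) (q : ℝ) (hq0 : 0 < q) (hq1 : q < 1)
    (p : Fin (n + 1) → ℕ) (hp : ∀ i, 0 < p i)
    (hcop : ∀ i j, i ≠ j → Nat.Coprime (p i) (p j))
    (r : Fin n → ℕ) (hr : ∀ j : Fin n, r j < p j.castSucc) :
    ∃ π : Fin (n + 1) → (QWP.sharpLens n q p →⋆ₙₐ[ℂ] (QWP.Hn n →L[ℂ] QWP.Hn n)),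
      -- `π` is the family of the representations `π_0, ..., π_n`, which exist and are unique
      (∀ k, QWP.IsBlockRep p r k (π k)) ∧
      (∀ π' : Fin (n + 1) → (QWP.sharpLens n q p →⋆ₙₐ[ℂ] (QWP.Hn n →L[ℂ] QWP.Hn n)),
        (∀ k, QWP.IsBlockRep p r k (π' k)) → π' = π) ∧
      -- `π_+(a) - π_-(a)` is of trace class, and its trace is an absolutely convergent series
      (∀ a : QWP.weightedProj n q (QWP.sharp p),
        QWP.IsTraceClass (QWP.piDiff π a) ∧
        Summable (fun m : Fin n → ℕ => ‖inner ℂ (QWP.ket m) (QWP.piDiff π a (QWP.ket m))‖) ∧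
        QWP.HasTrace (QWP.piDiff π a)
          (∑' m : Fin n → ℕ, inner ℂ (QWP.ket m) (QWP.piDiff π a (QWP.ket m)))) ∧
      -- `π_+ ⊕ π_-` with the flip and the grading is a `1`-summable even Fredholm module
      QWP.IsOneSummableEvenFredholmModule
        (fun a : QWP.weightedProj n q (QWP.sharp p) =>
          QWP.directSum (QWP.piPlus π (QWP.toLens a)) (QWP.piMinus π (QWP.toLens a)))
        (QWP.flipOp (QWP.Hn n)) (QWP.grading (QWP.Hn n)) := by
  obtain ⟨ρ₁, hρ₁⟩ := QWP.exists_piPlus hn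
    (QWP.isBlockRep_blockRep (r := r) hp hq0 hq1 hcop hr)
  obtain ⟨ρ₂, hρ₂⟩ := QWP.exists_piMinus hn
    (QWP.isBlockRep_blockRep (r := r) hp hq0 hq1 hcop hr)
  have hN := QWP.isNuclear_piDiff hn (QWP.isBlockRep_blockRep (r := r) hp hq0 hq1 hcop hr)
    hq0 hq1 hp hcop hr
  refine ⟨QWP.blockRep (r := r) hp hq0 hq1 hcop hr, QWP.isBlockRep_blockRep hp hq0 hq1 hcop hr,
    fun π' h' => funext fun k => QWP.IsBlockRep.ext hp hq0 hcop
      (QWP.isBlockRep_blockRep hp hq0 hq1 hcop hr k) (h' k),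
    fun a => ⟨(hN a).isTraceClass, (hN a).hasTrace_tsum⟩, ?_⟩
  let ι : QWP.weightedProj n q (QWP.sharp p) →⋆ₙₐ[ℂ] QWP.sharpLens n q p :=
    (StarSubalgebra.inclusion (QWP.weightedProj_le_lens n q (∏ j, p j) (QWP.sharp p)) :
      QWP.weightedProj n q (QWP.sharp p) →⋆ₐ[ℂ] QWP.sharpLens n q p)
  have h := QWP.isOneSummableEvenFredholmModule_directSum (ρ₁.comp ι) (ρ₂.comp ι) fun a => by
    change QWP.IsNuclear (ρ₁ (QWP.toLens a) - ρ₂ (QWP.toLens a))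
    rw [hρ₁, hρ₂]
    exact hN a
  have he : ∀ a, QWP.directSum (ρ₁.comp ι a) (ρ₂.comp ι a) =
      QWP.directSum (QWP.piPlus (QWP.blockRep hp hq0 hq1 hcop hr) (QWP.toLens a))
        (QWP.piMinus (QWP.blockRep hp hq0 hq1 hcop hr) (QWP.toLens a)) := fun a =>
    congrArg₂ QWP.directSum (hρ₁ _) (hρ₂ _)
  simpa only [he] using h
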